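/- Let $k$ be an algebraically closed field and let $\Gamma$ be a finite quiver with vertex set $I$ whose underlying unoriented graph is a disjoint union of Dynkin diagrams of types $A_n$, $D_n$, $E_6,E_7,E_8$. Let $\Phi$ be the corresponding root system with simple roots $\alpha_i$ ($i\in I$), let $Q=\bigoplus_{i}\mathbb Z\alpha_i$ be the root lattice, write $[\gamma:\alpha_i]$ for the coefficient of $\alpha_i$ in $\gamma\in Q$, and let $\Phi_{\ge -1}=\Phi_{>0}\cup\{-\alpha_i: i\in I\}$ be the set of almost positive roots. A decorated representation $M=M^+\oplus V$ of $\Gamma$ is a finite dimensional $k$-representation of the quiver obtained from $\Gamma$ by adding an isolated vertex $i^-$ for each $i\in I$; here $M^+$ is the part supported on $\Gamma$ and $V=(V_i)_{i\in I}$ consists of the spaces at the vertices $i^-$. Its signed dimension vector is $\underline{\mathrm{sdim}}(M)=\sum_{i}(\dim M_i-\dim V_i)\alpha_i$. For each $\alpha\in\Phi_{\ge -1}$ there is, up to isomorphism, exactly one indecomposable decorated representation $U_\alpha^\Gamma$ with signed dimension vector $\alpha$. For decorated representations $M=M^+\oplus V$ and $N=N^+\oplus W$ put $$E_\Gamma(M,N)=\mathrm{Ext}^1_\Gamma(M^+,N^+)\oplus\mathrm{Ext}^1_\Gamma(N^+,M^+)^*\oplus\bigoplus_{i}\mathrm{Hom}_k(M_i,W_i)\oplus\bigoplus_{i}\mathrm{Hom}_k(V_i,N_i),$$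 and for $\alpha,\beta\in\Phi_{\ge -1}$ define the compatibility degree $(\alpha\|\beta)_\Gamma=\dim_k E_\Gamma(U^\Gamma_\alpha,U^\Gamma_\beta)$. For $i\in I$ define $\sigma_i:Q\to Q$ by $[\sigma_i\gamma:\alpha_j]=[\gamma:\alpha_j]$ for $j\ne i$ and $$[\sigma_i\gamma:\alpha_i]=-[\gamma:\alpha_i]+\sum_{j}\max([\gamma:\alpha_j],0),$$ where the sum is over the vertices $j$ joined to $i$ by an edge. Suppose that $i\in I$ is a source or a sink of $\Gamma$, and let $s_i\Gamma$ be the quiver obtained from $\Gamma$ by reversing all arrows at $i$. Then for all $\alpha,\beta\in\Phi_{\ge -1}$ the elements $\sigma_i\alpha$ and $\sigma_i\beta$ lie in $\Phi_{\ge -1}$, and $$(\sigma_i\alpha\,\|\,\sigma_i\beta)_{s_i\Gamma}=(\alpha\|\beta)_\Gamma .$$ -/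

import Mathlib

universe u v

namespace DecQuiver

/-! ### Dynkin graphs, roots and truncated reflections -/

section Roots

/-- The graph attached to a simply-laced Cartan matrix: two different vertices are joined
by an edge when the corresponding entry is nonzero. -/
def dynkinGraph {n : ℕ} (A : Matrix (Fin n) (Fin n) ℤ) : SimpleGraph (Fin n) :=
  SimpleGraph.fromRel fun i j => A i j ≠ 0

/-- A graph all of whose connected components are Dynkin diagrams of type
`A_n`, `D_n` (`n ≥ 4`), `E₆`, `E₇` or `E₈`. -/
def IsDynkinGraph {I : Type v} (G : SimpleGraph I) : Prop :=
  ∀ c : G.ConnectedComponent,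
    (∃ n : ℕ, Nonempty (c.toSimpleGraph ≃g dynkinGraph (CartanMatrix.A n))) ∨
    (∃ n : ℕ, 4 ≤ n ∧ Nonempty (c.toSimpleGraph ≃g dynkinGraph (CartanMatrix.D n))) ∨
    Nonempty (c.toSimpleGraph ≃g dynkinGraph CartanMatrix.E₆) ∨
    Nonempty (c.toSimpleGraph ≃g dynkinGraph CartanMatrix.E₇) ∨
    Nonempty (c.toSimpleGraph ≃g dynkinGraph CartanMatrix.E₈)

variable {I : Type v} [Fintype I] [DecidableEq I]

open Classical in
/-- The simple reflection `s_i` on the root lattice `Q = ℤ^I`, written in the basis of simple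
roots: `s_i α = α - (α, α_i) α_i`, where `(α_i, α_i) = 2`, `(α_k, α_i) = -1` if `k` and `i` are
joined by an edge, and `(α_k, α_i) = 0` otherwise. -/
noncomputable def simpleReflection (G : SimpleGraph I) (i : I) (α : I → ℤ) : I → ℤ :=
  Function.update α i (-α i + ∑ k, if G.Adj k i then α k else 0)

/-- The root system `Φ` of the graph: the elements of the root lattice obtained from the simple
roots `α_j = Pi.single j 1` by applying simple reflections. -/
inductive IsRoot (G : SimpleGraph I) : (I → ℤ) → Prop
  | simple (j : I) : IsRoot G (Pi.single j 1)
  | reflect (i : I) {α : I → ℤ} : IsRoot G α → IsRoot G (simpleReflection G i α)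

/-- The set `Φ_{≥ -1}` of almost positive roots: positive roots and negative simple roots. -/
def almostPositiveRoots (G : SimpleGraph I) : Set (I → ℤ) :=
  {α | IsRoot G α ∧ ∀ j, 0 ≤ α j} ∪ {α | ∃ j : I, α = -Pi.single j 1}

open Classical in
/-- The piecewise-linear truncated reflection `σ_i` on the root lattice `Q = ℤ^I`. -/
noncomputable def truncatedReflection (G : SimpleGraph I) (i : I) (α : I → ℤ) : I → ℤ :=
  Function.update α i (-α i + ∑ k, if G.Adj k i then max (α k) 0 else 0)

end Roots

/-! ### Quivers -/

section Quivers

variable {I : Type v}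

/-- A quiver on the vertex set `I` (with at most one arrow between any two vertices, and no
loops) whose underlying unoriented graph is a disjoint union of Dynkin diagrams. -/
structure IsDynkinQuiver (Γ : Digraph I) : Prop where
  asymm : ∀ i j, Γ.Adj i j → ¬ Γ.Adj j i
  dynkin : IsDynkinGraph Γ.toSimpleGraphInclusive

/-- No arrow ends at `i`. -/
def IsSource (Γ : Digraph I) (i : I) : Prop := ∀ j, ¬ Γ.Adj j i

/-- No arrow starts at `i`. -/
def IsSink (Γ : Digraph I) (i : I) : Prop := ∀ j, ¬ Γ.Adj i j

/-- The quiver `s_i Γ` obtained from `Γ` by reversing all arrows at `i`. -/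
def reverseAt (Γ : Digraph I) (i : I) : Digraph I where
  Adj a b := ((a = i ∨ b = i) ∧ Γ.Adj b a) ∨ ((a ≠ i ∧ b ≠ i) ∧ Γ.Adj a b)

/-- The quiver obtained from `Γ` (the vertices `Sum.inl i`) by adding isolated vertices
`i⁻ = Sum.inr i`, one for every `i`. -/
def decorated (Γ : Digraph I) : Digraph (I ⊕ I) where
  Adj
    | Sum.inl i, Sum.inl j => Γ.Adj i j
    | _, _ => False

/-- The arrows of a quiver. -/
abbrev Arrow (Γ : Digraph I) : Type v := {p : I × I // Γ.Adj p.1 p.2}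

end Quivers

/-! ### Representations -/

section Representations

variable {I : Type v} {k : Type u} [Field k] {Γ : Digraph I}

/-- A finite dimensional representation of the quiver `Γ` over `k`. -/
structure Rep (k : Type u) [Field k] (Γ : Digraph I) where
  obj : I → Type u
  [addCommGroup : ∀ i, AddCommGroup (obj i)]
  [module : ∀ i, Module k (obj i)]
  [finite : ∀ i, Module.Finite k (obj i)]
  map : ∀ {i j : I}, Γ.Adj i j → (obj i →ₗ[k] obj j)

attribute [instance] Rep.addCommGroup Rep.module Rep.finite

/-- A morphism of representations. -/
structure Rep.Hom (M N : Rep k Γ) where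
  app : ∀ i, M.obj i →ₗ[k] N.obj i
  comm : ∀ {i j : I} (a : Γ.Adj i j), app j ∘ₗ M.map a = N.map a ∘ₗ app i

/-- `M` and `N` are isomorphic: there is a morphism that is bijective at every vertex. -/
def Rep.Isomorphic (M N : Rep k Γ) : Prop :=
  ∃ f : Rep.Hom M N, ∀ i, Function.Bijective (f.app i)

/-- The direct sum of two representations. -/
def Rep.directSum (M N : Rep k Γ) : Rep k Γ where
  obj i := M.obj i × N.obj i
  map a := (M.map a).prodMap (N.map a)

/-- `M` is the zero representation. -/
def Rep.IsZero (M : Rep k Γ) : Prop := ∀ i, Subsingleton (M.obj i)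

/-- `M` is indecomposable: it is nonzero, and whenever it is isomorphic to a direct sum, one of
the two summands is zero. -/
def Rep.Indecomposable (M : Rep k Γ) : Prop :=
  ¬ M.IsZero ∧ ∀ A B : Rep k Γ, M.Isomorphic (A.directSum B) → A.IsZero ∨ B.IsZero

end Representations

/-! ### The first extension group

A choice of a linear map `c a : M_i → N_j` for every arrow `a : i → j` (a cocycle) is the same as
the structure of a representation on the spaces `N_i × M_i` that is an extension of `M` by `N`;
two such extensions are equivalent when the cocycles differ by a coboundary. As every extension is
split at each vertex, `Ext¹(M, N)` is the space of cocycles modulo the coboundaries, and the sum of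
cocycles gives the Baer sum. -/

section Ext

variable {I : Type v} {k : Type u} [Field k] {Γ : Digraph I}

/-- Cocycles. -/
abbrev Cocycle (M N : Rep k Γ) : Type (max u v) :=
  ∀ a : Arrow Γ, M.obj a.1.1 →ₗ[k] N.obj a.1.2

/-- The coboundary map, sending `(f_i)` to `(N_a ∘ f_i - f_j ∘ M_a)` over the arrows
`a : i → j`. -/
def coboundary (M N : Rep k Γ) : (∀ i, M.obj i →ₗ[k] N.obj i) →ₗ[k] Cocycle M N where
  toFun f a := N.map a.2 ∘ₗ f a.1.1 - f a.1.2 ∘ₗ M.map a.2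
  map_add' f g := by
    funext a
    simp only [Pi.add_apply, LinearMap.comp_add, LinearMap.add_comp]
    abel
  map_smul' r f := by
    funext a
    simp only [Pi.smul_apply, LinearMap.comp_smul, LinearMap.smul_comp, RingHom.id_apply,
      smul_sub]

/-- The vector space `Ext¹_Γ(M, N)`. -/
abbrev Ext1 (M N : Rep k Γ) : Type (max u v) := Cocycle M N ⧸ LinearMap.range (coboundary M N)

/-- A short exact sequence `0 → N → E → M → 0`. -/
structure Extension (M N : Rep k Γ) where
  mid : Rep k Γ
  inc : Rep.Hom N mid
  proj : Rep.Hom mid M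
  injective : ∀ i, Function.Injective (inc.app i)
  surjective : ∀ i, Function.Surjective (proj.app i)
  exact : ∀ i, Function.Exact (inc.app i) (proj.app i)

/-- Equivalence of extensions: a morphism of the middle terms compatible with the identities of
`N` and `M` (such a morphism is bijective, by the five lemma). -/
def Extension.Equivalent {M N : Rep k Γ} (X Y : Extension M N) : Prop :=
  ∃ f : Rep.Hom X.mid Y.mid, ∀ i,
    f.app i ∘ₗ X.inc.app i = Y.inc.app i ∧ Y.proj.app i ∘ₗ f.app i = X.proj.app i

/-- The extension given by a cocycle. -/
def Extension.ofCocycle {M N : Rep k Γ} (c : Cocycle M N) : Extension M N where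
  mid :=
    { obj := fun i => N.obj i × M.obj i
      map := fun {i j} a =>
        LinearMap.prod ((N.map a).coprod (c ⟨(i, j), a⟩)) (M.map a ∘ₗ LinearMap.snd k _ _) }
  inc := { app := fun i => LinearMap.inl k _ _, comm := by intro i j a; ext <;> simp }
  proj := { app := fun i => LinearMap.snd k _ _, comm := by intro i j a; ext <;> simp }
  injective i := LinearMap.inl_injective
  surjective i := LinearMap.snd_surjective
  exact i := by
    intro x
    constructor
    · intro h
      exact ⟨x.1, Prod.ext rfl h.symm⟩
    · rintro ⟨y, rfl⟩
      rfl

/-- Every extension is equivalent to one given by a cocycle. -/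
theorem Extension.exists_ofCocycle {M N : Rep k Γ} (X : Extension M N) :
    ∃ c : Cocycle M N, (Extension.ofCocycle c).Equivalent X := by
  have hs : ∀ i, ∃ s : M.obj i →ₗ[k] X.mid.obj i, X.proj.app i ∘ₗ s = LinearMap.id := fun i =>
    (X.proj.app i).exists_rightInverse_of_surjective (LinearMap.range_eq_top.2 (X.surjective i))
  choose s hs using hs
  have hr : ∀ i, ∃ r : X.mid.obj i →ₗ[k] N.obj i, r ∘ₗ X.inc.app i = LinearMap.id := fun i =>
    (X.inc.app i).exists_leftInverse_of_injective (LinearMap.ker_eq_bot.2 (X.injective i))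
  choose r hr using hr
  have hs' : ∀ i x, X.proj.app i (s i x) = x := fun i x => LinearMap.congr_fun (hs i) x
  have hr' : ∀ i x, r i (X.inc.app i x) = x := fun i x => LinearMap.congr_fun (hr i) x
  refine ⟨fun a => r a.1.2 ∘ₗ (X.mid.map a.2 ∘ₗ s a.1.1 - s a.1.2 ∘ₗ M.map a.2),
    { app := fun i => (X.inc.app i).coprod (s i), comm := ?_ }, ?_⟩
  · intro i j a
    refine LinearMap.ext fun x => ?_
    have h1 : X.mid.map a (X.inc.app i x.1) = X.inc.app j (N.map a x.1) :=
      (LinearMap.congr_fun (X.inc.comm a) x.1).symm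
    have h2 : X.proj.app j (X.mid.map a (s i x.2)) = M.map a x.2 := by
      have := LinearMap.congr_fun (X.proj.comm a) (s i x.2)
      simpa [hs'] using this
    obtain ⟨y, hy⟩ := (X.exact j (X.mid.map a (s i x.2) - s j (M.map a x.2))).1
      (by rw [map_sub, h2, hs', sub_self])
    have h3 : X.inc.app j (r j (X.mid.map a (s i x.2) - s j (M.map a x.2)))
        = X.mid.map a (s i x.2) - s j (M.map a x.2) := by rw [← hy, hr']
    change X.inc.app j (N.map a x.1 + r j (X.mid.map a (s i x.2) - s j (M.map a x.2)))
        + s j (M.map a x.2) = X.mid.map a (X.inc.app i x.1 + s i x.2)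
    rw [map_add, h3, map_add, h1]
    abel
  · intro i
    constructor
    · refine LinearMap.ext fun x => ?_
      change X.inc.app i x + s i 0 = X.inc.app i x
      rw [map_zero, add_zero]
    · refine LinearMap.ext fun x => ?_
      have h0 : X.proj.app i (X.inc.app i x.1) = 0 := (X.exact i _).2 ⟨_, rfl⟩
      change X.proj.app i (X.inc.app i x.1 + s i x.2) = x.2
      rw [map_add, h0, hs', zero_add]

/-- Two cocycles give equivalent extensions exactly when they have the same class in `Ext¹`. -/
theorem Extension.ofCocycle_equivalent_iff {M N : Rep k Γ} (c d : Cocycle M N) :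
    (Extension.ofCocycle c).Equivalent (Extension.ofCocycle d) ↔
      (Submodule.Quotient.mk c : Ext1 M N) = Submodule.Quotient.mk d := by
  rw [Submodule.Quotient.eq]
  constructor
  · rintro ⟨f, hf⟩
    let F : ∀ i, (N.obj i × M.obj i) →ₗ[k] (N.obj i × M.obj i) := f.app
    have h1 : ∀ i n, F i (n, 0) = (n, 0) := fun i n => LinearMap.congr_fun (hf i).1 n
    have h2 : ∀ i x, (F i x).2 = x.2 := fun i x => LinearMap.congr_fun (hf i).2 x
    refine ⟨fun i => LinearMap.fst k _ _ ∘ₗ F i ∘ₗ LinearMap.inr k _ _, ?_⟩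
    funext a
    refine LinearMap.ext fun m => ?_
    have h3 : (F a.1.2 (N.map a.2 0 + c a m, M.map a.2 m)).1
        = N.map a.2 (F a.1.1 (0, m)).1 + d a (F a.1.1 (0, m)).2 :=
      congrArg Prod.fst (LinearMap.congr_fun (f.comm a.2) (0, m))
    have h4 : F a.1.2 (N.map a.2 0 + c a m, M.map a.2 m)
        = (c a m, 0) + F a.1.2 (0, M.map a.2 m) := by
      rw [← h1, ← map_add]
      simp
    rw [h4, h2, Prod.fst_add] at h3
    change N.map a.2 (F a.1.1 (0, m)).1 - (F a.1.2 (0, M.map a.2 m)).1 = c a m - d a m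
    rw [sub_eq_sub_iff_add_eq_add]
    exact h3.symm
  · rintro ⟨g, hg⟩
    refine ⟨{ app := fun i => LinearMap.prod ((LinearMap.id).coprod (g i)) (LinearMap.snd k _ _),
              comm := ?_ }, ?_⟩
    · intro i j a
      have h1 : ∀ m, N.map a (g i m) - g j (M.map a m) = c ⟨(i, j), a⟩ m - d ⟨(i, j), a⟩ m :=
        fun m => LinearMap.congr_fun (congrFun hg ⟨(i, j), a⟩) m
      refine LinearMap.ext fun x => Prod.ext ?_ rfl
      have h2 := h1 x.2
      rw [sub_eq_sub_iff_add_eq_add] at h2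
      change N.map a x.1 + c ⟨(i, j), a⟩ x.2 + g j (M.map a x.2)
        = N.map a (x.1 + g i x.2) + d ⟨(i, j), a⟩ x.2
      rw [map_add, add_assoc, add_assoc, h2]
    · intro i
      constructor
      · refine LinearMap.ext fun x => ?_
        change ((x + g i 0, 0) : N.obj i × M.obj i) = (x, 0)
        rw [map_zero, add_zero]
      · rfl

end Ext

/-! ### Decorated representations and the compatibility degree -/

section Decorated

variable {I : Type v} [Fintype I] {k : Type u} [Field k] {Γ : Digraph I}

/-- The part `M⁺` of a decorated representation `M = M⁺ ⊕ V` supported on `Γ`. -/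
def Rep.plus (M : Rep k (decorated Γ)) : Rep k Γ where
  obj i := M.obj (Sum.inl i)
  map {i j} a := M.map (i := Sum.inl i) (j := Sum.inl j) a

/-- The component `V_i` of the graded space `V` of a decorated representation `M = M⁺ ⊕ V`. -/
abbrev Rep.dec (M : Rep k (decorated Γ)) (i : I) : Type u := M.obj (Sum.inr i)

/-- The signed dimension vector of a decorated representation. -/
noncomputable def Rep.sdim (M : Rep k (decorated Γ)) (i : I) : ℤ :=
  (Module.finrank k (M.plus.obj i) : ℤ) - Module.finrank k (M.dec i)

/-- The vector space `E_Γ(M, N)`, for `M = M⁺ ⊕ V` and `N = N⁺ ⊕ W`: the direct sum of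
`Ext¹(M⁺, N⁺)`, the dual of `Ext¹(N⁺, M⁺)`, `Hom^I(M⁺, W)` and `Hom^I(V, N⁺)`. -/
abbrev ESpace (M N : Rep k (decorated Γ)) : Type (max u v) :=
  Ext1 M.plus N.plus × Module.Dual k (Ext1 N.plus M.plus) ×
    (∀ i, M.plus.obj i →ₗ[k] N.dec i) × (∀ i, M.dec i →ₗ[k] N.plus.obj i)

/-- `U` represents the isomorphism class `[U_α]`: it is indecomposable of signed dimension
vector `α`, and is up to isomorphism the only such decorated representation. -/
def Rep.IsRootRep (U : Rep k (decorated Γ)) (α : I → ℤ) : Prop :=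
  U.Indecomposable ∧ U.sdim = α ∧
    ∀ U' : Rep k (decorated Γ), U'.Indecomposable → U'.sdim = α → U'.Isomorphic U

/-- The `Γ`-compatibility degree `(α ‖ β)_Γ` is defined and equal to `d`, that is,
`d = dim E_Γ(U_α, U_β)`. -/
def HasCompatDegree (k : Type u) [Field k] (Γ : Digraph I) (α β : I → ℤ) (d : ℕ) : Prop :=
  ∃ U V : Rep k (decorated Γ), U.IsRootRep α ∧ V.IsRootRep β ∧
    Module.finrank k (ESpace U V) = d

end Decorated

end DecQuiver

/-! If `i` is a sink, the Bernstein–Gelfand–Ponomarev reflection functor at `i` matches the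
representations of Γ that are generated at `i` by the incoming arrows with the representations of
`s_i Γ` that embed at `i` into their neighbours. It acts on dimension vectors by the simple
reflection, and it preserves dimensions of Hom spaces (`ReflectionData.finrank_homSpace_eq`). The
Euler form equals dim Hom minus dim Ext¹ (`finrank_homSpace_sub_finrank_ext1`) and is itself
invariant (`IsSinkReflection.eulerForm_eq`), so dimensions of Ext¹ are preserved too. The decoration
terms of `ESpace` away from `i` do not change, and those at `i` vanish for such representations.
This settles every pair in which neither root is ±α_i (`IsSinkReflection.finrank_eSpace_generic`).

The roots α_i and -α_i are exchanged by σ_i, and this is not the work of a functor. Pairing with the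
simple at `i⁻` gives dim N_i. Pairing with the simple at `i` gives, since the relevant Hom vanishes,
minus a value of the Euler form, which is the dimension at `i` of the reflected representation. The
two answers agree (`finrank_eSpace_inr`, `IsSinkReflection.finrank_eSpace_sink`,
`IsSinkReflection.finrank_eSpace_source`). The source case follows by applying the sink case to
`reverseAt Γ i`, because σ_i is an involution.

The compatibility degree only makes sense if U_α exists and is unique, so Gabriel's theorem is
proved as well (`hasUniqueBrick_of_titsForm`). A subadditive function on each diagram makes the Tits
form positive definite, hence there are finitely many roots. Reflections at sinks transport unique
existence, and simple roots have it. A root without it would therefore stay a nonnegative root under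
all powers of a Coxeter element; the sum over its finite orbit would be a fixed vector, hence zero,
which is absurd.

The functors are not built as functors: `ReflectionData` is a relation between a representation of Γ
and one of `s_i Γ`, and only existence of partners and dimension counts are needed. -/

namespace DecQuiver

/-! ### Positive definiteness of the Tits form of a Dynkin graph -/

section Tits

open Classical in
/-- The sum of `d` over the neighbours of `a`. -/
noncomputable def neighborSum {V : Type v} [Fintype V] (G : SimpleGraph V) (d : V → ℤ) (a : V) :
    ℤ :=
  ∑ b, if G.Adj a b then d b else 0

/-- Twice the Tits form of a graph. -/
noncomputable def titsForm {V : Type v} [Fintype V] (G : SimpleGraph V) (x : V → ℤ) : ℤ :=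
  2 * ∑ a, x a ^ 2 - ∑ a, x a * neighborSum G x a

/-- A positive subadditive function that is strictly subadditive somewhere on every
connected component. -/
structure IsSubadditive {V : Type v} [Fintype V] (G : SimpleGraph V) (d : V → ℤ) : Prop where
  pos : ∀ a, 0 < d a
  le : ∀ a, neighborSum G d a ≤ 2 * d a
  lt : ∀ a, ∃ b, G.Reachable a b ∧ neighborSum G d b < 2 * d b

variable {V : Type v} [Fintype V]

-- Completing squares after the substitution x = d·y. Each edge appears twice in the double sum over
-- ordered pairs, whence the factor 2 on the other terms.
open Classical in
lemma titsForm_eq_sum_sq (G : SimpleGraph V) (x d : V → ℤ) (hd : ∀ a, 0 < d a) :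
    2 * (titsForm G x : ℚ) =
      2 * ∑ a, d a * (2 * d a - neighborSum G d a : ℚ) * (x a / d a : ℚ) ^ 2 +
      ∑ a, ∑ b, if G.Adj a b then (d a * d b : ℚ) * (x a / d a - x b / d b : ℚ) ^ 2 else 0 := by
  have hd' : ∀ a, (d a : ℚ) ≠ 0 := fun a => by exact_mod_cast (hd a).ne'
  have h1 : ∑ a, d a * (2 * d a - neighborSum G d a : ℚ) * (x a / d a : ℚ) ^ 2 =
      2 * ∑ a, (x a : ℚ) ^ 2 -
        ∑ a, ∑ b, if G.Adj a b then (d b / d a : ℚ) * (x a : ℚ) ^ 2 else 0 := by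
    rw [Finset.mul_sum, ← Finset.sum_sub_distrib]
    refine Finset.sum_congr rfl fun a _ => ?_
    have : (∑ b, if G.Adj a b then (d b / d a : ℚ) * (x a : ℚ) ^ 2 else 0) =
        (neighborSum G d a : ℚ) * ((x a : ℚ) ^ 2 / d a) := by
      simp only [neighborSum, Int.cast_sum, Finset.sum_mul]
      refine Finset.sum_congr rfl fun b _ => ?_
      split_ifs
      · field_simp
      · simp
    rw [this]
    have := hd' a
    field_simp
  have h2 : (∑ a, ∑ b, if G.Adj a b then (d a * d b : ℚ) * (x a / d a - x b / d b : ℚ) ^ 2 else 0)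
      = (∑ a, ∑ b, if G.Adj a b then (d b / d a : ℚ) * (x a : ℚ) ^ 2 else 0) +
        (∑ a, ∑ b, if G.Adj a b then (d a / d b : ℚ) * (x b : ℚ) ^ 2 else 0) -
        2 * ∑ a, ∑ b, if G.Adj a b then (x a * x b : ℚ) else 0 := by
    simp only [Finset.mul_sum, ← Finset.sum_add_distrib, ← Finset.sum_sub_distrib]
    refine Finset.sum_congr rfl fun a _ => Finset.sum_congr rfl fun b _ => ?_
    have := hd' a
    have := hd' b
    split_ifs
    · field_simp
      ring
    · simp
  have h3 : (∑ a, ∑ b, if G.Adj a b then (d a / d b : ℚ) * (x b : ℚ) ^ 2 else 0) =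
      ∑ a, ∑ b, if G.Adj a b then (d b / d a : ℚ) * (x a : ℚ) ^ 2 else 0 := by
    rw [Finset.sum_comm]
    simp only [G.adj_comm]
  have h4 : (titsForm G x : ℚ) =
      2 * ∑ a, (x a : ℚ) ^ 2 - ∑ a, ∑ b, if G.Adj a b then (x a * x b : ℚ) else 0 := by
    simp only [titsForm, neighborSum, Int.cast_sub, Int.cast_mul, Int.cast_sum, Int.cast_pow,
      Finset.mul_sum]
    push_cast
    congr 1
    refine Finset.sum_congr rfl fun a _ => Finset.sum_congr rfl fun b _ => ?_
    split_ifs <;> simp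
  rw [h1, h2, h3, h4]
  ring

/-- A graph with a subadditive function has a positive definite Tits form. -/
theorem IsSubadditive.titsForm_pos {G : SimpleGraph V} {d : V → ℤ} (h : IsSubadditive G d)
    {x : V → ℤ} (hx : x ≠ 0) : 0 < titsForm G x := by
  classical
  by_contra! hn
  have hd' : ∀ a, (0 : ℚ) < d a := fun a => by exact_mod_cast h.pos a
  have hle : ∀ a, (0 : ℚ) ≤ 2 * d a - neighborSum G d a := fun a => by
    have := h.le a
    rw [sub_nonneg]
    exact_mod_cast this
  have key := titsForm_eq_sum_sq G x d h.pos
  have hn' : (titsForm G x : ℚ) ≤ 0 := by exact_mod_cast hn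
  have n1 : ∀ a ∈ Finset.univ,
      0 ≤ d a * (2 * d a - neighborSum G d a : ℚ) * (x a / d a : ℚ) ^ 2 := fun a _ =>
    mul_nonneg (mul_nonneg (hd' a).le (hle a)) (sq_nonneg _)
  have n2 : ∀ a b, (0 : ℚ) ≤
      if G.Adj a b then (d a * d b : ℚ) * (x a / d a - x b / d b : ℚ) ^ 2 else 0 := fun a b => by
    split_ifs
    · exact mul_nonneg (mul_nonneg (hd' a).le (hd' b).le) (sq_nonneg _)
    · exact le_rfl
  have n3 : ∀ a ∈ Finset.univ, (0 : ℚ) ≤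
      ∑ b, if G.Adj a b then (d a * d b : ℚ) * (x a / d a - x b / d b : ℚ) ^ 2 else 0 :=
    fun a _ => Finset.sum_nonneg fun b _ => n2 a b
  have s1 := Finset.sum_nonneg n1
  have s2 := Finset.sum_nonneg n3
  -- Both sums of nonnegative terms vanish. The edge terms make x/d constant on connected
  -- components; the vertex terms kill it where subadditivity is strict.
  have z1 := (Finset.sum_eq_zero_iff_of_nonneg n1).1 (by linarith)
  have z2 := (Finset.sum_eq_zero_iff_of_nonneg n3).1 (by linarith)
  have hadj : ∀ a b, G.Adj a b → (x a / d a : ℚ) = x b / d b := fun a b hab => by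
    have := (Finset.sum_eq_zero_iff_of_nonneg fun b _ => n2 a b).1 (z2 a (Finset.mem_univ a)) b
      (Finset.mem_univ b)
    rw [if_pos hab] at this
    have h0 : (d a * d b : ℚ) ≠ 0 := (mul_pos (hd' a) (hd' b)).ne'
    have := pow_eq_zero_iff (two_ne_zero) |>.1 ((mul_eq_zero.1 this).resolve_left h0)
    linarith
  have hreach : ∀ a b, G.Reachable a b → (x a / d a : ℚ) = x b / d b := by
    rintro a b ⟨p⟩
    induction p with
    | nil => rfl
    | cons hab _ ih => rw [hadj _ _ hab, ih]
  refine hx (funext fun a => ?_)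
  obtain ⟨b, hab, hb⟩ := h.lt a
  have hb' : (0 : ℚ) < 2 * d b - neighborSum G d b := by
    rw [sub_pos]
    exact_mod_cast hb
  have := z1 b (Finset.mem_univ b)
  have := pow_eq_zero_iff (two_ne_zero) |>.1
    ((mul_eq_zero.1 this).resolve_left (mul_pos (hd' b) hb').ne')
  rw [← hreach a b hab, div_eq_zero_iff] at this
  have := this.resolve_right (hd' a).ne'
  exact_mod_cast this

/-! ### Subadditive functions on the Dynkin diagrams -/

open Classical in
lemma neighborSum_dynkinGraph {n : ℕ} (A : Matrix (Fin n) (Fin n) ℤ) (d : Fin n → ℤ) (a : Fin n) :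
    neighborSum (dynkinGraph A) d a =
      ∑ b, if a ≠ b ∧ (A a b ≠ 0 ∨ A b a ≠ 0) then d b else 0 := by
  simp only [neighborSum, dynkinGraph, SimpleGraph.fromRel_adj]

lemma sum_ite_val_eq_le {n : ℕ} (c : ℕ) {e : ℤ} (he : 0 ≤ e) :
    (∑ b : Fin n, if b.val = c then e else 0) ≤ e := by
  by_cases hc : c < n
  · rw [Finset.sum_eq_single (⟨c, hc⟩ : Fin n)]
    · simp
    · intro b _ hb
      rw [if_neg fun h => hb (Fin.ext h)]
    · simp
  · rw [Finset.sum_eq_zero]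
    · exact he
    · intro b _
      rw [if_neg]
      omega

lemma neighborSum_dynkinGraph_A {n : ℕ} (a : Fin n) :
    neighborSum (dynkinGraph (CartanMatrix.A n)) (fun _ => 1) a ≤ 2 ∧
      (a.val = 0 → neighborSum (dynkinGraph (CartanMatrix.A n)) (fun _ => 1) a < 2) := by
  classical
  rw [neighborSum_dynkinGraph]
  have h1 : ∀ b : Fin n, a ≠ b ∧ (CartanMatrix.A n a b ≠ 0 ∨ CartanMatrix.A n b a ≠ 0) →
      b.val = a.val + 1 ∨ b.val + 1 = a.val := by
    rintro b ⟨hab, h⟩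
    by_contra hn
    simp only [CartanMatrix.A, Matrix.of_apply, if_neg hab, if_neg hab.symm] at h
    rw [if_neg (by omega), if_neg (by omega)] at h
    simp at h
  constructor
  -- At `a = 0` the truncated `a.val - 1` counts vertex 0 itself, which is harmless in an upper
  -- bound.
  · calc _ ≤ ∑ b : Fin n, ((if b.val = a.val + 1 then (1 : ℤ) else 0) +
          (if b.val = a.val - 1 then (1 : ℤ) else 0)) := by
          refine Finset.sum_le_sum fun b _ => ?_
          have := h1 b
          grind
      _ ≤ 1 + 1 := by
          rw [Finset.sum_add_distrib]
          exact add_le_add (sum_ite_val_eq_le _ (by norm_num)) (sum_ite_val_eq_le _ (by norm_num))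
      _ = 2 := by norm_num
  · intro ha
    calc _ ≤ ∑ b : Fin n, (if b.val = a.val + 1 then (1 : ℤ) else 0) := by
          refine Finset.sum_le_sum fun b _ => ?_
          have := h1 b
          grind
      _ ≤ 1 := sum_ite_val_eq_le _ (by norm_num)
      _ < 2 := by norm_num

/-- The function is 2 along the chain and 1 on the two leaves `n - 2`, `n - 1` of the fork, as in
the null root of the affine diagram. It is strict at the free end of the chain. -/
lemma neighborSum_dynkinGraph_D {n : ℕ} (hn : 4 ≤ n) (a : Fin n) :
    neighborSum (dynkinGraph (CartanMatrix.D n)) (fun b => if b.val + 2 < n then 2 else 1) a ≤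
        2 * (if a.val + 2 < n then 2 else 1) ∧
      (a.val = 0 →
        neighborSum (dynkinGraph (CartanMatrix.D n)) (fun b => if b.val + 2 < n then 2 else 1) a <
        2 * (if a.val + 2 < n then 2 else 1)) := by
  classical
  rw [neighborSum_dynkinGraph]
  have h1 : ∀ b : Fin n, a ≠ b ∧ (CartanMatrix.D n a b ≠ 0 ∨ CartanMatrix.D n b a ≠ 0) →
      (b.val = a.val + 1 ∧ b.val + 2 < n) ∨ (b.val + 1 = a.val ∧ a.val + 2 < n) ∨
      (a.val + 3 = n ∧ (b.val + 2 = n ∨ b.val + 1 = n)) ∨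
      (b.val + 3 = n ∧ (a.val + 2 = n ∨ a.val + 1 = n)) := by
    rintro b ⟨hab, h⟩
    by_contra hc
    simp only [CartanMatrix.D, Matrix.of_apply, if_neg hab, if_neg hab.symm] at h
    rw [if_neg (by omega), if_neg (by omega), if_neg (by omega), if_neg (by omega),
      if_neg (by omega), if_neg (by omega), if_neg (by omega), if_neg (by omega),
      if_neg (by omega), if_neg (by omega)] at h
    simp at h
  have e1 := fun c => sum_ite_val_eq_le (n := n) c (e := 1) (by norm_num)
  have e2 := fun c => sum_ite_val_eq_le (n := n) c (e := 2) (by norm_num)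
  constructor
  -- Three positions: on the chain before the branch vertex, at the branch vertex `n - 3`, and at a
  -- leaf of the fork.
  · by_cases h2 : a.val + 3 < n
    · calc _ ≤ ∑ b : Fin n, ((if b.val = a.val + 1 then (2 : ℤ) else 0) +
            (if b.val = a.val - 1 then (2 : ℤ) else 0)) := by
            refine Finset.sum_le_sum fun b _ => ?_
            have := h1 b
            grind
        _ ≤ 2 + 2 := by
            rw [Finset.sum_add_distrib]
            exact add_le_add (e2 _) (e2 _)
        _ ≤ _ := by rw [if_pos (by omega)]; norm_num
    by_cases h3 : a.val + 3 = n
    · calc _ ≤ ∑ b : Fin n, ((if b.val = a.val - 1 then (2 : ℤ) else 0) +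
            ((if b.val = n - 2 then (1 : ℤ) else 0) + (if b.val = n - 1 then (1 : ℤ) else 0))) := by
            refine Finset.sum_le_sum fun b _ => ?_
            have := h1 b
            grind
        _ ≤ 2 + (1 + 1) := by
            rw [Finset.sum_add_distrib, Finset.sum_add_distrib]
            exact add_le_add (e2 _) (add_le_add (e1 _) (e1 _))
        _ ≤ _ := by rw [if_pos (by omega)]; norm_num
    · calc _ ≤ ∑ b : Fin n, (if b.val = n - 3 then (2 : ℤ) else 0) := by
            refine Finset.sum_le_sum fun b _ => ?_
            have := h1 b
            grind
        _ ≤ 2 := e2 _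
        _ ≤ _ := by rw [if_neg (by omega)]; norm_num
  · intro ha
    calc _ ≤ ∑ b : Fin n, (if b.val = a.val + 1 then (2 : ℤ) else 0) := by
          refine Finset.sum_le_sum fun b _ => ?_
          have := h1 b
          grind
      _ ≤ 2 := e2 _
      _ < _ := by rw [if_pos (by omega)]; norm_num

/-- The values are the coefficients of the highest root of E₈, truncated for E₆ and E₇. Strictness
occurs at the end of the long arm, where the next vertex of affine E₈ has been cut off. -/
lemma neighborSum_dynkinGraph_E₆ :
    (∀ a, neighborSum (dynkinGraph CartanMatrix.E₆) ![2, 3, 4, 6, 5, 4] a ≤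
      2 * (![2, 3, 4, 6, 5, 4] : Fin 6 → ℤ) a) ∧
    neighborSum (dynkinGraph CartanMatrix.E₆) ![2, 3, 4, 6, 5, 4] 5 < 2 * 4 := by
  classical
  simp only [neighborSum_dynkinGraph, CartanMatrix.E₆]
  constructor
  · intro a
    fin_cases a <;> simp [Fin.sum_univ_succ]
  · simp [Fin.sum_univ_succ]

lemma neighborSum_dynkinGraph_E₇ :
    (∀ a, neighborSum (dynkinGraph CartanMatrix.E₇) ![2, 3, 4, 6, 5, 4, 3] a ≤
      2 * (![2, 3, 4, 6, 5, 4, 3] : Fin 7 → ℤ) a) ∧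
    neighborSum (dynkinGraph CartanMatrix.E₇) ![2, 3, 4, 6, 5, 4, 3] 6 < 2 * 3 := by
  classical
  simp only [neighborSum_dynkinGraph, CartanMatrix.E₇]
  constructor
  · intro a
    fin_cases a <;> simp [Fin.sum_univ_succ]
  · simp [Fin.sum_univ_succ]

lemma neighborSum_dynkinGraph_E₈ :
    (∀ a, neighborSum (dynkinGraph CartanMatrix.E₈) ![2, 3, 4, 6, 5, 4, 3, 2] a ≤
      2 * (![2, 3, 4, 6, 5, 4, 3, 2] : Fin 8 → ℤ) a) ∧
    neighborSum (dynkinGraph CartanMatrix.E₈) ![2, 3, 4, 6, 5, 4, 3, 2] 7 < 2 * 2 := by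
  classical
  simp only [neighborSum_dynkinGraph, CartanMatrix.E₈]
  constructor
  · intro a
    fin_cases a <;> simp [Fin.sum_univ_succ]
  · simp [Fin.sum_univ_succ]

/-- A positive function on a component, subadditive with respect to the whole graph and strictly
so at some vertex. -/
lemma exists_subadditive_of_component {G : SimpleGraph V} (c : G.ConnectedComponent) {n : ℕ}
    {H : SimpleGraph (Fin n)} (e : c.toSimpleGraph ≃g H) (d : Fin n → ℤ) (hpos : ∀ a, 0 < d a)
    (hle : ∀ a, neighborSum H d a ≤ 2 * d a) (a₀ : Fin n) (hlt : neighborSum H d a₀ < 2 * d a₀) :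
    ∃ f : V → ℤ, (∀ a, 0 < f a) ∧
      (∀ a, G.connectedComponentMk a = c → neighborSum G f a ≤ 2 * f a) ∧
      ∃ b, G.connectedComponentMk b = c ∧ neighborSum G f b < 2 * f b := by
  classical
  let f : V → ℤ := fun a => if h : a ∈ c.supp then d (e ⟨a, h⟩) else 1
  have hf : ∀ (a : V) (h : a ∈ c.supp), f a = d (e ⟨a, h⟩) := fun a h => dif_pos h
  have hs : ∀ (a : V) (h : a ∈ c.supp), neighborSum G f a = neighborSum H d (e ⟨a, h⟩) := by
    intro a h
    refine (Fintype.sum_of_injective (fun j => (e.symm j).1)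
      (Subtype.val_injective.comp e.symm.injective) _ _ (fun b hb => ?_) (fun j => ?_)).symm
    · refine if_neg fun hab => hb ?_
      have hbc : b ∈ c.supp :=
        (SimpleGraph.ConnectedComponent.sound hab.reachable).symm.trans h
      exact ⟨e ⟨b, hbc⟩, by simp⟩
    · have h1 : H.Adj (e ⟨a, h⟩) j ↔ G.Adj a (e.symm j).1 := by
        rw [← e.symm.map_adj_iff, RelIso.symm_apply_apply]
        rfl
      simp only [h1]
      rw [hf _ (e.symm j).2]
      simp
  refine ⟨f, ?_, ?_, ?_⟩
  · intro a
    by_cases h : a ∈ c.supp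
    · rw [hf a h]; exact hpos _
    · simp only [f, dif_neg h]; norm_num
  · intro a ha
    have h : a ∈ c.supp := ha
    rw [hs a h, hf a h]
    exact hle _
  · refine ⟨e.symm a₀, (e.symm a₀).2, ?_⟩
    rw [hs _ (e.symm a₀).2, hf _ (e.symm a₀).2]
    simpa using hlt

/-- The Tits form of a Dynkin graph is positive definite. -/
theorem IsDynkinGraph.titsForm_pos {G : SimpleGraph V} (hG : IsDynkinGraph G) {x : V → ℤ}
    (hx : x ≠ 0) : 0 < titsForm G x := by
  classical
  have key : ∀ c : G.ConnectedComponent, ∃ f : V → ℤ, (∀ a, 0 < f a) ∧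
      (∀ a, G.connectedComponentMk a = c → neighborSum G f a ≤ 2 * f a) ∧
      ∃ b, G.connectedComponentMk b = c ∧ neighborSum G f b < 2 * f b := by
    intro c
    rcases hG c with ⟨n, ⟨e⟩⟩ | ⟨n, hn, ⟨e⟩⟩ | ⟨⟨e⟩⟩ | ⟨⟨e⟩⟩ | ⟨⟨e⟩⟩
    · have h0 : 0 < n := by
        obtain ⟨a, ha⟩ := c.nonempty_supp
        exact Fin.pos (e ⟨a, ha⟩)
      exact exists_subadditive_of_component c e (fun _ => 1) (by simp)
        (fun a => by simpa using (neighborSum_dynkinGraph_A a).1) ⟨0, h0⟩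
        (by simpa using (neighborSum_dynkinGraph_A (⟨0, h0⟩ : Fin n)).2 rfl)
    · exact exists_subadditive_of_component c e (fun b => if b.val + 2 < n then 2 else 1)
        (fun a => by split_ifs <;> norm_num)
        (fun a => (neighborSum_dynkinGraph_D hn a).1) ⟨0, by omega⟩
        ((neighborSum_dynkinGraph_D hn (⟨0, by omega⟩ : Fin n)).2 rfl)
    · exact exists_subadditive_of_component c e _ (by decide) neighborSum_dynkinGraph_E₆.1 5
        neighborSum_dynkinGraph_E₆.2
    · exact exists_subadditive_of_component c e _ (by decide) neighborSum_dynkinGraph_E₇.1 6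
        neighborSum_dynkinGraph_E₇.2
    · exact exists_subadditive_of_component c e _ (by decide) neighborSum_dynkinGraph_E₈.1 7
        neighborSum_dynkinGraph_E₈.2
  choose f hpos hle b hb hlt using key
  -- The functions of the components glue, since all neighbours of a vertex use the same function as
  -- the vertex.
  have hs : ∀ a, neighborSum G (fun a => f (G.connectedComponentMk a) a) a =
      neighborSum G (f (G.connectedComponentMk a)) a := by
    intro a
    refine Finset.sum_congr rfl fun w _ => ?_
    split_ifs with h
    · rw [SimpleGraph.ConnectedComponent.sound h.reachable]
    · rfl
  have : IsSubadditive G fun a => f (G.connectedComponentMk a) a :=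
    { pos := fun a => hpos _ a
      le := fun a => by rw [hs]; exact hle _ a rfl
      lt := fun a => ⟨b (G.connectedComponentMk a),
        (SimpleGraph.ConnectedComponent.exact (hb (G.connectedComponentMk a))).symm, by
          rw [hs, hb]; exact hlt _⟩ }
  exact this.titsForm_pos hx

end Tits

/-! ### The Tits form and simple reflections -/

section Reflections

variable {V : Type v} [Fintype V] [DecidableEq V] {G : SimpleGraph V}

/-- The value of the symmetric bilinear form on `x` and the simple root at `a`. -/
noncomputable def rootPairing (G : SimpleGraph V) (x : V → ℤ) (a : V) : ℤ :=
  2 * x a - neighborSum G x a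

omit [DecidableEq V] in
lemma titsForm_eq_sum_rootPairing (x : V → ℤ) :
    titsForm G x = ∑ a, x a * rootPairing G x a := by
  simp only [titsForm, rootPairing, mul_sub, Finset.sum_sub_distrib, Finset.mul_sum]
  congr 1
  exact Finset.sum_congr rfl fun a _ => by ring

omit [DecidableEq V] in
lemma neighborSum_add (x y : V → ℤ) (a : V) :
    neighborSum G (x + y) a = neighborSum G x a + neighborSum G y a := by
  simp only [neighborSum, ← Finset.sum_add_distrib]
  refine Finset.sum_congr rfl fun b _ => ?_
  split_ifs <;> simp

open Classical in
lemma neighborSum_single (i : V) (c : ℤ) (a : V) :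
    neighborSum G (Pi.single i c) a = if G.Adj a i then c else 0 := by
  rw [neighborSum, Finset.sum_eq_single i]
  · simp
  · intro b _ hb
    simp [Pi.single_eq_of_ne hb]
  · simp

lemma simpleReflection_eq (i : V) (x : V → ℤ) :
    simpleReflection G i x = x + Pi.single i (-rootPairing G x i) := by
  funext a
  by_cases ha : a = i
  · subst ha
    classical
    have : (∑ b, if G.Adj b a then x b else 0) = neighborSum G x a :=
      Finset.sum_congr rfl fun b _ => if_congr (G.adj_comm b a) rfl rfl
    simp only [simpleReflection, Function.update_self, Pi.add_apply, Pi.single_eq_same,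
      rootPairing, this]
    ring
  · simp [simpleReflection, ha]

/-- Expansion of (x + cα_i, x + cα_i) with (α_i, α_i) = 2. The choice c = -(x, α_i) gives invariance
under reflections, and c = ±1 bounds the pairing with simple roots. -/
lemma titsForm_add_single (x : V → ℤ) (i : V) (c : ℤ) :
    titsForm G (x + Pi.single i c) = titsForm G x + 2 * c ^ 2 + 2 * c * rootPairing G x i := by
  classical
  have h1 : ∑ a, x a * neighborSum G (Pi.single i c) a = c * neighborSum G x i := by
    simp only [neighborSum_single]
    rw [neighborSum, Finset.mul_sum]
    refine Finset.sum_congr rfl fun a _ => ?_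
    simp only [G.adj_comm i a]
    split_ifs <;> ring
  have h2 : ∀ f : V → ℤ, ∑ a, (Pi.single i c : V → ℤ) a * f a = c * f i := fun f => by
    rw [Finset.sum_eq_single i]
    · simp
    · intro b _ hb
      simp [Pi.single_eq_of_ne hb]
    · simp
  have h3 : neighborSum G (Pi.single i c) i = 0 := by simp [neighborSum_single]
  simp only [titsForm, rootPairing, Pi.add_apply, neighborSum_add, add_sq, add_mul, mul_add,
    Finset.sum_add_distrib, h1, h2, h3, Finset.mul_sum]
  have h4 : ∑ a, 2 * (2 * x a * (Pi.single i c : V → ℤ) a) = 4 * x i * c := by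
    rw [Finset.sum_eq_single i]
    · simp; ring
    · intro b _ hb
      simp [Pi.single_eq_of_ne hb]
    · simp
  have h5 : ∑ a, 2 * (Pi.single i c : V → ℤ) a ^ 2 = 2 * c ^ 2 := by
    rw [Finset.sum_eq_single i]
    · simp
    · intro b _ hb
      simp [Pi.single_eq_of_ne hb]
    · simp
  rw [h4, h5]
  ring

lemma titsForm_simpleReflection (i : V) (x : V → ℤ) :
    titsForm G (simpleReflection G i x) = titsForm G x := by
  rw [simpleReflection_eq, titsForm_add_single]
  ring

omit [DecidableEq V] in
lemma titsForm_zero : titsForm G 0 = 0 := by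
  simp [titsForm]

lemma titsForm_single (i : V) (c : ℤ) : titsForm G (Pi.single i c) = 2 * c ^ 2 := by
  have := titsForm_add_single (G := G) 0 i c
  rw [zero_add, titsForm_zero] at this
  rw [this]
  simp [rootPairing, neighborSum]

lemma IsRoot.titsForm_eq {x : V → ℤ} (hx : IsRoot G x) : titsForm G x = 2 := by
  induction hx with
  | simple j => simp [titsForm_single]
  | reflect i _ ih => rw [titsForm_simpleReflection, ih]

/-- Only the coordinate at `i` changes. If it became c < 0, write the reflected vector as y + cα_i
with y ≥ 0 vanishing at `i` and nonzero. Then (y, α_i) ≤ 0, so its norm is at least (y, y) + 2c² >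
2, against invariance. -/
lemma simpleReflection_nonneg (hG : ∀ x, x ≠ 0 → 0 < titsForm G x) {x : V → ℤ} (hx : 0 ≤ x)
    (hq : titsForm G x = 2) {i : V} (hi : x ≠ Pi.single i 1) : 0 ≤ simpleReflection G i x := by
  by_contra hn
  set c := simpleReflection G i x i with hc
  have hne : ∀ a, a ≠ i → simpleReflection G i x a = x a := fun a ha => by
    simp [simpleReflection, ha]
  have hc0 : c < 0 := by
    by_contra! h0
    refine hn fun a => ?_
    by_cases ha : a = i
    · rw [ha]; exact h0
    · rw [hne a ha]; exact hx a
  set y : V → ℤ := Function.update x i 0 with hy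
  have hyx : simpleReflection G i x = y + Pi.single i c := by
    funext a
    by_cases ha : a = i
    · subst ha; simp [hy, hc]
    · simp [hne a ha, hy, ha]
  have hy0 : y ≠ 0 := by
    intro h0
    have hxi : x = Pi.single i (x i) := by
      funext a
      by_cases ha : a = i
      · subst ha; simp
      · have := congrFun h0 a
        simpa [hy, ha] using this
    have h2 : titsForm G x = 2 * x i ^ 2 := by
      conv_lhs => rw [hxi]
      exact titsForm_single _ _
    have h3 : x i = 1 := by
      have := hx i
      simp only [Pi.zero_apply] at this
      nlinarith
    exact hi (by rw [hxi, h3])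
  have h1 : rootPairing G y i ≤ 0 := by
    have : 0 ≤ neighborSum G y i := by
      refine Finset.sum_nonneg fun b _ => ?_
      split_ifs
      · by_cases hb : b = i
        · simp [hy, hb]
        · simpa [hy, hb] using hx b
      · exact le_rfl
    simp only [rootPairing]
    simp [hy] at this ⊢
    exact this
  have h2 := titsForm_add_single (G := G) y i c
  rw [← hyx, titsForm_simpleReflection, hq] at h2
  have h3 := hG y hy0
  nlinarith

lemma simpleReflection_add (i : V) (x y : V → ℤ) :
    simpleReflection G i (x + y) = simpleReflection G i x + simpleReflection G i y := by
  simp only [simpleReflection_eq, rootPairing, neighborSum_add]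
  funext a
  by_cases ha : a = i
  · subst ha; simp; ring
  · simp [ha]

lemma simpleReflection_apply_of_ne {i a : V} (ha : a ≠ i) (x : V → ℤ) :
    simpleReflection G i x a = x a := by
  simp [simpleReflection, ha]

omit [DecidableEq V] in
lemma eq_zero_of_rootPairing (hG : ∀ x, x ≠ 0 → 0 < titsForm G x) {x : V → ℤ}
    (h : ∀ i, rootPairing G x i = 0) : x = 0 := by
  by_contra hx
  have := hG x hx
  rw [titsForm_eq_sum_rootPairing] at this
  simp [h] at this

/-- There are finitely many vectors on which the Tits form has the value one. -/
lemma finite_titsForm_eq (hG : ∀ x, x ≠ 0 → 0 < titsForm G x) :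
    {x : V → ℤ | titsForm G x = 2}.Finite := by
  have hnn : ∀ x, 0 ≤ titsForm G x := fun x => by
    by_cases hx : x = 0
    · rw [hx, titsForm_zero]
    · exact (hG x hx).le
  -- A vector is determined by its pairings with the simple roots, and 0 ≤ (x ± α_a, x ± α_a) = 4 ±
  -- 2(x, α_a) confines these to [-2, 2].
  refine Set.Finite.of_injOn (f := rootPairing G) (t := Set.pi Set.univ fun _ => Set.Icc (-2) 2)
    ?_ ?_ (Set.Finite.pi fun _ => Set.finite_Icc _ _)
  · intro x hx a _
    have hx' : titsForm G x = 2 := hx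
    have h1 := titsForm_add_single (G := G) x a 1
    have h2 := titsForm_add_single (G := G) x a (-1)
    have h3 := hnn (x + Pi.single a 1)
    have h4 := hnn (x + Pi.single a (-1))
    constructor <;> linarith
  · intro x _ y _ hxy
    have h : ∀ i, rootPairing G (x - y) i = 0 := by
      intro i
      have h1 : rootPairing G x i = rootPairing G y i := congrFun hxy i
      have h2 : rootPairing G (x - y + y) i =
          rootPairing G (x - y) i + rootPairing G y i := by
        simp only [rootPairing, neighborSum_add, Pi.add_apply]
        ring
      rw [sub_add_cancel] at h2
      linarith
    exact sub_eq_zero.1 (eq_zero_of_rootPairing hG h)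

/-! ### Orbits of a Coxeter element -/

/-- The composition of the simple reflections in a list of vertices, the head of the list being
applied first. -/
noncomputable def reflectList (G : SimpleGraph V) : List V → (V → ℤ) → V → ℤ
  | [], x => x
  | i :: l, x => reflectList G l (simpleReflection G i x)

lemma reflectList_add (l : List V) (x y : V → ℤ) :
    reflectList G l (x + y) = reflectList G l x + reflectList G l y := by
  induction l generalizing x y with
  | nil => rfl
  | cons i l ih => simp only [reflectList, simpleReflection_add, ih]

lemma reflectList_zero (l : List V) : reflectList G l 0 = 0 := by
  have := reflectList_add (G := G) l 0 0
  rw [add_zero] at this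
  exact left_eq_add.1 this

lemma reflectList_sum {ι : Type*} (s : Finset ι) (l : List V) (x : ι → V → ℤ) :
    reflectList G l (∑ j ∈ s, x j) = ∑ j ∈ s, reflectList G l (x j) := by
  classical
  induction s using Finset.induction_on with
  | empty => simp [reflectList_zero]
  | insert a s ha ih => rw [Finset.sum_insert ha, Finset.sum_insert ha, reflectList_add, ih]

lemma reflectList_apply_of_notMem {l : List V} {a : V} (ha : a ∉ l) (x : V → ℤ) :
    reflectList G l x a = x a := by
  induction l generalizing x with
  | nil => rfl
  | cons i l ih =>
    rw [List.mem_cons, not_or] at ha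
    rw [reflectList, ih ha.2, simpleReflection_apply_of_ne ha.1]

/-- As no vertex repeats, the coordinate at the head `i` is changed only by the first reflection. A
fixed vector is thus fixed by that reflection, and the argument continues with the tail. -/
lemma rootPairing_eq_zero_of_reflectList {l : List V} (hl : l.Nodup) {x : V → ℤ}
    (hx : reflectList G l x = x) : ∀ i ∈ l, rootPairing G x i = 0 := by
  induction l with
  | nil => simp
  | cons i l ih =>
    rw [List.nodup_cons] at hl
    have h1 : rootPairing G x i = 0 := by
      have := congrFun hx i
      rw [reflectList, reflectList_apply_of_notMem hl.1, simpleReflection_eq] at this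
      simpa using this
    have h2 : simpleReflection G i x = x := by
      rw [simpleReflection_eq, h1]
      simp
    rw [reflectList, h2] at hx
    intro j hj
    rcases List.mem_cons.1 hj with rfl | hj
    · exact h1
    · exact ih hl.2 hx j hj

/-- A Coxeter element has no infinite orbit of nonnegative roots. -/
lemma exists_iterate_reflectList (hG : ∀ x, x ≠ 0 → 0 < titsForm G x) {l : List V}
    (hl : l.Nodup) (hmem : ∀ i, i ∈ l) {x : V → ℤ} :
    ∃ m, ¬ (0 ≤ (reflectList G l)^[m] x ∧ titsForm G ((reflectList G l)^[m] x) = 2) := by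
  by_contra! hn
  have hfin := finite_titsForm_eq hG
  obtain ⟨m, n, hmn, hx⟩ : ∃ m n, m < n ∧ (reflectList G l)^[m] x = (reflectList G l)^[n] x := by
    by_contra! h
    have hinj : Function.Injective fun m => (reflectList G l)^[m] x := by
      intro m n hmn
      rcases lt_trichotomy m n with h1 | h1 | h1
      · exact absurd hmn (h m n h1)
      · exact h1
      · exact absurd hmn.symm (h n m h1)
    exact Set.infinite_of_injective_forall_mem hinj (fun m => (hn m).2) hfin
  obtain ⟨p, rfl⟩ := Nat.exists_eq_add_of_lt hmn
  -- The period is `p + 1`, so the Coxeter element permutes the summands and fixes `z`. Hence `z` is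
  -- orthogonal to all simple roots and vanishes, and so does each nonnegative summand.
  set z : V → ℤ := ∑ j ∈ Finset.range (p + 1), (reflectList G l)^[m + j] x with hz
  have hfix : reflectList G l z = z := by
    rw [hz, reflectList_sum]
    simp only [← Function.iterate_succ_apply']
    have h1 := Finset.sum_range_succ' (fun j => (reflectList G l)^[m + j] x) (p + 1)
    have h2 := Finset.sum_range_succ (fun j => (reflectList G l)^[m + j] x) (p + 1)
    rw [h1] at h2
    have h3 : (reflectList G l)^[m + 0] x = (reflectList G l)^[m + (p + 1)] x := by
      rw [add_zero, hx]; rfl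
    rw [h3] at h2
    exact add_right_cancel h2
  have hz0 : z = 0 :=
    eq_zero_of_rootPairing hG fun i => rootPairing_eq_zero_of_reflectList hl hfix i (hmem i)
  have hm0 : (reflectList G l)^[m] x = 0 := by
    have := (Finset.sum_eq_zero_iff_of_nonneg fun j _ => (hn (m + j)).1).1 (hz ▸ hz0) 0 (by simp)
    simpa using this
  have := (hn m).2
  rw [hm0, titsForm_zero] at this
  norm_num at this

end Reflections

/-! ### The Euler form and reflections of quivers -/

section Digraphs

variable {V : Type v} {Γ Γ' : Digraph V}

open Classical in
/-- The Euler form of a quiver. -/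
noncomputable def eulerForm [Fintype V] (Γ : Digraph V) (x y : V → ℤ) : ℤ :=
  ∑ a, x a * y a - ∑ a, ∑ b, if Γ.Adj a b then x a * y b else 0

/-- The vertex `i` is a sink of `Γ`, and `Γ'` arises from `Γ` by reversing the arrows at `i`. -/
structure IsSinkReflection (Γ Γ' : Digraph V) (i : V) : Prop where
  sink : ∀ j, ¬ Γ.Adj i j
  source : ∀ j, ¬ Γ'.Adj j i
  adj_iff : ∀ j, Γ'.Adj i j ↔ Γ.Adj j i
  adj_iff_of_ne : ∀ a b, a ≠ i → b ≠ i → (Γ'.Adj a b ↔ Γ.Adj a b)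

lemma IsSinkReflection.toSimpleGraph_eq {i : V} (h : IsSinkReflection Γ Γ' i) :
    Γ'.toSimpleGraphInclusive = Γ.toSimpleGraphInclusive := by
  ext a b
  simp only [Digraph.toSimpleGraphInclusive, SimpleGraph.fromRel_adj]
  refine and_congr_right fun hab => ?_
  by_cases ha : a = i
  · subst ha
    simp [h.adj_iff, h.sink, h.source]
  · by_cases hb : b = i
    · subst hb
      simp [h.adj_iff, h.sink, h.source]
    · rw [h.adj_iff_of_ne a b ha hb, h.adj_iff_of_ne b a hb ha]

open Classical in
lemma IsSinkReflection.simpleReflection_apply [Fintype V] [DecidableEq V] {i : V}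
    (h : IsSinkReflection Γ Γ' i) (x : V → ℤ) :
    simpleReflection Γ.toSimpleGraphInclusive i x i =
      -x i + ∑ j, if Γ.Adj j i then x j else 0 := by
  simp only [simpleReflection, Function.update_self]
  congr 1
  refine Finset.sum_congr rfl fun j _ => ?_
  have : Γ.toSimpleGraphInclusive.Adj j i ↔ Γ.Adj j i := by
    simp only [Digraph.toSimpleGraphInclusive, SimpleGraph.fromRel_adj]
    constructor
    · rintro ⟨_, h1 | h1⟩
      · exact h1
      · exact absurd h1 (h.sink _)
    · intro h1
      exact ⟨fun hj => h.sink i (hj ▸ h1), Or.inl h1⟩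
  simp only [this]

open Classical in
lemma sum_sum_eq_of_sink [Fintype V] [DecidableEq V] {i : V} (h : ∀ j, ¬ Γ.Adj i j) (x y : V → ℤ) :
    (∑ a, ∑ b, if Γ.Adj a b then x a * y b else 0) =
      (∑ a, if Γ.Adj a i then x a else 0) * y i +
        ∑ a ∈ Finset.univ.erase i, ∑ b ∈ Finset.univ.erase i,
          if Γ.Adj a b then x a * y b else 0 := by
  have h1 : ∀ a, (∑ b, if Γ.Adj a b then x a * y b else 0) =
      (if Γ.Adj a i then x a else 0) * y i +
      ∑ b ∈ Finset.univ.erase i, if Γ.Adj a b then x a * y b else 0 := fun a => by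
    rw [← Finset.add_sum_erase _ _ (Finset.mem_univ i), ite_mul, zero_mul]
  simp only [h1, Finset.sum_add_distrib, Finset.sum_mul]
  congr 1
  rw [← Finset.add_sum_erase _ _ (Finset.mem_univ i)]
  simp [h]

open Classical in
lemma sum_sum_eq_of_source [Fintype V] [DecidableEq V] {i : V} (h : ∀ j, ¬ Γ.Adj j i)
    (x y : V → ℤ) :
    (∑ a, ∑ b, if Γ.Adj a b then x a * y b else 0) =
      x i * (∑ b, if Γ.Adj i b then y b else 0) +
        ∑ a ∈ Finset.univ.erase i, ∑ b ∈ Finset.univ.erase i,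
          if Γ.Adj a b then x a * y b else 0 := by
  rw [← Finset.add_sum_erase _ _ (Finset.mem_univ i), Finset.mul_sum]
  congr 1
  · exact Finset.sum_congr rfl fun b _ => by rw [mul_ite, mul_zero]
  · refine Finset.sum_congr rfl fun a _ => ?_
    rw [← Finset.add_sum_erase _ _ (Finset.mem_univ i)]
    simp [h]

open Classical in
/-- Reflections preserve the Euler form. -/
lemma IsSinkReflection.eulerForm_eq [Fintype V] [DecidableEq V] {i : V}
    (h : IsSinkReflection Γ Γ' i) (x y : V → ℤ) :
    eulerForm Γ' (simpleReflection Γ.toSimpleGraphInclusive i x)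
      (simpleReflection Γ.toSimpleGraphInclusive i y) = eulerForm Γ x y := by
  have hx := h.simpleReflection_apply x
  have hy := h.simpleReflection_apply y
  set x' := simpleReflection Γ.toSimpleGraphInclusive i x with hx'
  set y' := simpleReflection Γ.toSimpleGraphInclusive i y with hy'
  have ex : ∀ a, a ≠ i → x' a = x a := fun a ha => simpleReflection_apply_of_ne ha x
  have ey : ∀ a, a ≠ i → y' a = y a := fun a ha => simpleReflection_apply_of_ne ha y
  rw [eulerForm, eulerForm, sum_sum_eq_of_sink h.sink, sum_sum_eq_of_source h.source]
  have h1 : (∑ a ∈ Finset.univ.erase i, ∑ b ∈ Finset.univ.erase i,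
      if Γ'.Adj a b then x' a * y' b else 0) = ∑ a ∈ Finset.univ.erase i,
      ∑ b ∈ Finset.univ.erase i, if Γ.Adj a b then x a * y b else 0 := by
    refine Finset.sum_congr rfl fun a ha => Finset.sum_congr rfl fun b hb => ?_
    have ha' := Finset.ne_of_mem_erase ha
    have hb' := Finset.ne_of_mem_erase hb
    simp only [h.adj_iff_of_ne a b ha' hb', ex a ha', ey b hb']
  have h2 : (∑ b, if Γ'.Adj i b then y' b else 0) = ∑ b, if Γ.Adj b i then y b else 0 := by
    refine Finset.sum_congr rfl fun b _ => ?_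
    simp only [h.adj_iff]
    split_ifs with hb
    · exact ey b fun hbi => h.sink i (hbi ▸ hb)
    · rfl
  have h3 : ∑ a, x' a * y' a = x' i * y' i + ∑ a ∈ Finset.univ.erase i, x a * y a := by
    rw [← Finset.add_sum_erase _ _ (Finset.mem_univ i)]
    congr 1
    refine Finset.sum_congr rfl fun a ha => ?_
    rw [ex a (Finset.ne_of_mem_erase ha), ey a (Finset.ne_of_mem_erase ha)]
  have h4 : ∑ a, x a * y a = x i * y i + ∑ a ∈ Finset.univ.erase i, x a * y a :=
    (Finset.add_sum_erase _ _ (Finset.mem_univ i)).symm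
  rw [h1, h2, h3, h4]
  -- Only terms at `i` are left: x'_i(y'_i - Σ y_j) on one side and (x_i - Σ x_j)y_i on the other,
  -- both equal to -x'_i y_i.
  linear_combination x' i * hy - y i * hx

open Classical in
lemma titsForm_eq_two_mul_eulerForm [Fintype V] (hΓ : ∀ a b, Γ.Adj a b → ¬ Γ.Adj b a)
    (x : V → ℤ) : titsForm Γ.toSimpleGraphInclusive x = 2 * eulerForm Γ x x := by
  have h1 : ∑ a, x a * neighborSum Γ.toSimpleGraphInclusive x a =
      (∑ a, ∑ b, if Γ.Adj a b then x a * x b else 0) +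
        ∑ a, ∑ b, if Γ.Adj b a then x b * x a else 0 := by
    simp only [neighborSum, Finset.mul_sum, ← Finset.sum_add_distrib]
    refine Finset.sum_congr rfl fun a _ => Finset.sum_congr rfl fun b _ => ?_
    have hadj : Γ.toSimpleGraphInclusive.Adj a b ↔ Γ.Adj a b ∨ Γ.Adj b a := by
      simp only [Digraph.toSimpleGraphInclusive, SimpleGraph.fromRel_adj]
      refine ⟨And.right, fun h => ⟨?_, h⟩⟩
      rintro rfl
      rcases h with h | h <;> exact hΓ _ _ h h
    simp only [hadj]
    by_cases hab : Γ.Adj a b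
    · simp [hab, hΓ a b hab]
    · by_cases hba : Γ.Adj b a
      · simp [hab, hba, mul_comm]
      · simp [hab, hba]
  have h2 : (∑ a, ∑ b, if Γ.Adj b a then x b * x a else 0) =
      ∑ a, ∑ b, if Γ.Adj a b then x a * x b else 0 := Finset.sum_comm
  rw [titsForm, eulerForm, h1, h2]
  simp only [pow_two]
  ring

/-! ### Admissible sequences of sinks -/

/-- A sequence of reflections in sinks leading from one quiver to another. -/
inductive SinkSequence : Digraph V → List V → Digraph V → Prop
  | nil (Γ : Digraph V) : SinkSequence Γ [] Γ
  | cons {Γ Γ' Γ'' : Digraph V} {i : V} {l : List V} (h : IsSinkReflection Γ Γ' i)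
      (hl : SinkSequence Γ' l Γ'') : SinkSequence Γ (i :: l) Γ''

/-- Reversal of the arrows between a set of vertices and its complement. -/
def reverseCut (Γ : Digraph V) (S : Finset V) : Digraph V where
  Adj a b := ((a ∈ S ↔ b ∈ S) ∧ Γ.Adj a b) ∨ (¬ (a ∈ S ↔ b ∈ S) ∧ Γ.Adj b a)

/-- If every vertex of `T` had an arrow into `T`, there would be at least |T| arrows inside `T`, and
the Euler form would be ≤ 0 on the indicator of `T`. Positivity thus replaces an acyclicity
argument. -/
lemma exists_sink_of_titsForm_pos [Fintype V] (hΓ : ∀ a b, Γ.Adj a b → ¬ Γ.Adj b a)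
    (hpos : ∀ x, x ≠ 0 → 0 < titsForm Γ.toSimpleGraphInclusive x) {T : Finset V}
    (hT : T.Nonempty) : ∃ i ∈ T, ∀ b ∈ T, ¬ Γ.Adj i b := by
  classical
  by_contra! hn
  let x : V → ℤ := fun a => if a ∈ T then 1 else 0
  have hx : x ≠ 0 := by
    obtain ⟨a, ha⟩ := hT
    intro h0
    have := congrFun h0 a
    simp [x, ha] at this
  have h1 := hpos x hx
  rw [titsForm_eq_two_mul_eulerForm hΓ, eulerForm, ← Finset.sum_sub_distrib] at h1
  have hnn : ∀ a, 0 ≤ x a := fun a => by simp only [x]; split_ifs <;> norm_num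
  have h2 : ∑ a, (x a * x a - ∑ b, if Γ.Adj a b then x a * x b else 0) ≤ 0 := by
    refine Finset.sum_nonpos fun a _ => ?_
    by_cases ha : a ∈ T
    · obtain ⟨b, hb, hab⟩ := hn a ha
      have := Finset.single_le_sum (f := fun b => if Γ.Adj a b then x a * x b else 0)
        (fun b _ => by
          split_ifs
          · exact mul_nonneg (hnn a) (hnn b)
          · exact le_rfl) (Finset.mem_univ b)
      simp only [if_pos hab] at this
      have ea : x a = 1 := by simp [x, ha]
      have eb : x b = 1 := by simp [x, hb]
      rw [eb] at this
      rw [ea] at this ⊢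
      linarith
    · simp [x, ha]
  linarith

/-- `S` is the set of vertices already reflected, closed under outgoing arrows, and `reverseCut Γ S`
is the quiver reached: an arrow with both ends in `S` has been reversed twice. A sink `i` of the
complement of `S` is a sink of `reverseCut Γ S`, since its arrows into `S` are currently reversed.
When `S` is everything, Γ is back. -/
lemma exists_sinkSequence_aux [Fintype V] (hΓ : ∀ a b, Γ.Adj a b → ¬ Γ.Adj b a)
    (hpos : ∀ x, x ≠ 0 → 0 < titsForm Γ.toSimpleGraphInclusive x) (n : ℕ) (S : Finset V)
    (hS : ∀ a ∈ S, ∀ b, Γ.Adj a b → b ∈ S) (hn : S.card + n = Fintype.card V) :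
    ∃ l : List V, l.Nodup ∧ (∀ a, a ∈ l ↔ a ∉ S) ∧ SinkSequence (reverseCut Γ S) l Γ := by
  classical
  induction n generalizing S with
  | zero =>
    have hu : S = Finset.univ := Finset.eq_univ_of_card _ (by simpa using hn)
    refine ⟨[], List.nodup_nil, by simp [hu], ?_⟩
    have : reverseCut Γ S = Γ := by
      ext a b
      simp [reverseCut, hu]
    rw [this]
    exact .nil _
  | succ n ih =>
    have hne : Sᶜ.Nonempty := by
      rw [← Finset.card_pos, Finset.card_compl]
      omega
    obtain ⟨i, hi, hsink⟩ := exists_sink_of_titsForm_pos hΓ hpos hne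
    rw [Finset.mem_compl] at hi
    have hsink' : ∀ b, Γ.Adj i b → b ∈ S := fun b hb => by
      by_contra hbS
      exact hsink b (Finset.mem_compl.2 hbS) hb
    obtain ⟨l, hl, hmem, hseq⟩ := ih (insert i S)
      (by
        intro a ha b hab
        rcases Finset.mem_insert.1 ha with rfl | ha
        · exact Finset.mem_insert_of_mem (hsink' b hab)
        · exact Finset.mem_insert_of_mem (hS a ha b hab))
      (by rw [Finset.card_insert_of_notMem hi]; omega)
    have hloop : ¬ Γ.Adj i i := fun h => hΓ i i h h
    refine ⟨i :: l, List.nodup_cons.2 ⟨by simp [hmem], hl⟩, ?_, .cons ?_ hseq⟩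
    · intro a
      rw [List.mem_cons, hmem, Finset.mem_insert]
      by_cases ha : a = i
      · simp [ha, hi]
      · simp [ha]
    · constructor
      · intro j
        have := hsink' j
        have := hS j
        simp only [reverseCut]
        grind
      · intro j
        have := hsink' j
        have := hS j
        simp only [reverseCut, Finset.mem_insert]
        grind
      · intro j
        simp only [reverseCut, Finset.mem_insert]
        grind
      · intro a b ha hb
        simp only [reverseCut, Finset.mem_insert]
        grind

/-- A quiver with positive definite Tits form has an admissible ordering of its vertices. -/
lemma exists_sinkSequence [Fintype V] (hΓ : ∀ a b, Γ.Adj a b → ¬ Γ.Adj b a)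
    (hpos : ∀ x, x ≠ 0 → 0 < titsForm Γ.toSimpleGraphInclusive x) :
    ∃ l : List V, l.Nodup ∧ (∀ a, a ∈ l) ∧ SinkSequence Γ l Γ := by
  obtain ⟨l, hl, hmem, h⟩ := exists_sinkSequence_aux hΓ hpos (Fintype.card V) ∅ (by simp) (by simp)
  have : reverseCut Γ ∅ = Γ := by
    ext a b
    simp [reverseCut]
  rw [this] at h
  exact ⟨l, hl, by simpa using hmem, h⟩

end Digraphs

/-! ### Homomorphisms, extensions and the Euler form -/

section HomExt

variable {V : Type v} {k : Type u} [Field k] {Γ : Digraph V}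

/-- The space of homomorphisms between two representations. -/
abbrev homSpace (M N : Rep k Γ) : Submodule k (∀ a, M.obj a →ₗ[k] N.obj a) :=
  LinearMap.ker (coboundary M N)

lemma mem_homSpace {M N : Rep k Γ} {f : ∀ a, M.obj a →ₗ[k] N.obj a} :
    f ∈ homSpace M N ↔ ∀ a b (h : Γ.Adj a b) x, f b (M.map h x) = N.map h (f a x) := by
  rw [LinearMap.mem_ker]
  constructor
  · intro hf a b h x
    have := LinearMap.congr_fun (congrFun hf ⟨(a, b), h⟩) x
    exact (sub_eq_zero.1 this).symm
  · intro hf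
    funext ⟨⟨a, b⟩, h⟩
    refine LinearMap.ext fun x => ?_
    exact sub_eq_zero.2 (hf a b h x).symm

/-- The dimension vector of a representation. -/
noncomputable def Rep.dimVec (M : Rep k Γ) (a : V) : ℤ := Module.finrank k (M.obj a)

lemma Rep.dimVec_nonneg (M : Rep k Γ) : 0 ≤ M.dimVec := fun a => by
  simp [Rep.dimVec]

lemma Rep.subsingleton_of_dimVec {M : Rep k Γ} {a : V} (h : M.dimVec a = 0) :
    Subsingleton (M.obj a) := by
  rw [← Module.finrank_zero_iff (R := k)]
  unfold Rep.dimVec at h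
  exact_mod_cast h

lemma Rep.dimVec_eq_zero (M : Rep k Γ) (a : V) [Subsingleton (M.obj a)] : M.dimVec a = 0 := by
  simp [Rep.dimVec, Module.finrank_zero_of_subsingleton]

instance [Fintype V] : Finite (Arrow Γ) := inferInstanceAs (Finite {p : V × V // Γ.Adj p.1 p.2})

lemma finrank_hom_eq [Fintype V] (M N : Rep k Γ) :
    (Module.finrank k (∀ a, M.obj a →ₗ[k] N.obj a) : ℤ) = ∑ a, M.dimVec a * N.dimVec a := by
  rw [Module.finrank_pi_fintype]
  simp [Rep.dimVec, Module.finrank_linearMap]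

open Classical in
lemma finrank_cocycle_eq [Fintype V] (M N : Rep k Γ) :
    (Module.finrank k (Cocycle M N) : ℤ) =
      ∑ a, ∑ b, if Γ.Adj a b then M.dimVec a * N.dimVec b else 0 := by
  have : Fintype (Arrow Γ) := Fintype.ofFinite _
  rw [← Fintype.sum_prod_type' fun a b => if Γ.Adj a b then M.dimVec a * N.dimVec b else 0,
    ← Finset.sum_filter, Finset.sum_subtype (F := this) _ (by simp),
    Module.finrank_pi_fintype]
  simp [Rep.dimVec, Module.finrank_linearMap]

/-- The Euler form computes the Euler characteristic of the extension groups. -/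
theorem finrank_homSpace_sub_finrank_ext1 [Fintype V] (M N : Rep k Γ) :
    (Module.finrank k (homSpace M N) : ℤ) - Module.finrank k (Ext1 M N) =
      eulerForm Γ M.dimVec N.dimVec := by
  -- `coboundary M N` has kernel Hom and cokernel Ext¹, so the difference of their dimensions is
  -- that of source and target.
  have h1 := LinearMap.finrank_range_add_finrank_ker (coboundary M N)
  have h2 := Submodule.finrank_quotient_add_finrank (LinearMap.range (coboundary M N))
  change _ + Module.finrank k (homSpace M N) = _ at h1
  change Module.finrank k (Ext1 M N) + _ = _ at h2
  rw [eulerForm, ← finrank_hom_eq, ← finrank_cocycle_eq]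
  omega

lemma finrank_ext1_eq_zero_of_cocycle (M N : Rep k Γ)
    (h : ∀ a b, Γ.Adj a b → Subsingleton (M.obj a) ∨ Subsingleton (N.obj b)) :
    Module.finrank k (Ext1 M N) = 0 := by
  have : Subsingleton (Cocycle M N) := by
    refine ⟨fun f g => funext fun a => LinearMap.ext fun x => ?_⟩
    rcases h _ _ a.2 with h | h
    · rw [Subsingleton.elim x 0, map_zero, map_zero]
    · exact Subsingleton.elim _ _
  exact Module.finrank_zero_of_subsingleton

end HomExt

/-! ### Isomorphisms, subrepresentations and indecomposability -/

section Indecomposable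

variable {V : Type v} {k : Type u} [Field k] {Γ : Digraph V}

lemma Rep.Isomorphic.symm {M N : Rep k Γ} (h : M.Isomorphic N) : N.Isomorphic M := by
  obtain ⟨f, hf⟩ := h
  refine ⟨{ app := fun a => (LinearEquiv.ofBijective (f.app a) (hf a)).symm.toLinearMap,
            comm := fun {a b} h => LinearMap.ext fun x => ?_ },
    fun a => (LinearEquiv.ofBijective (f.app a) (hf a)).symm.bijective⟩
  obtain ⟨y, rfl⟩ := (hf a).2 x
  refine (hf b).1 ?_
  have h1 := LinearMap.congr_fun (f.comm h) y
  simp only [LinearMap.comp_apply] at h1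
  have h2 : ∀ (c : V) z, f.app c ((LinearEquiv.ofBijective (f.app c) (hf c)).symm z) = z :=
    fun c z => (LinearEquiv.ofBijective (f.app c) (hf c)).apply_symm_apply z
  have h3 : ∀ (c : V) z, (LinearEquiv.ofBijective (f.app c) (hf c)).symm (f.app c z) = z :=
    fun c z => (LinearEquiv.ofBijective (f.app c) (hf c)).symm_apply_apply z
  simp only [LinearMap.comp_apply, LinearEquiv.coe_coe, h2, h3, h1]

lemma Rep.Isomorphic.trans {L M N : Rep k Γ} (h : L.Isomorphic M) (h' : M.Isomorphic N) :
    L.Isomorphic N := by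
  obtain ⟨f, hf⟩ := h
  obtain ⟨g, hg⟩ := h'
  exact ⟨{ app := fun a => g.app a ∘ₗ f.app a,
           comm := fun h => by
            rw [LinearMap.comp_assoc, f.comm, ← LinearMap.comp_assoc, g.comm,
              LinearMap.comp_assoc] },
    fun a => (hg a).comp (hf a)⟩

lemma Rep.Isomorphic.dimVec_eq {M N : Rep k Γ} (h : M.Isomorphic N) : M.dimVec = N.dimVec := by
  obtain ⟨f, hf⟩ := h
  funext a
  simp only [Rep.dimVec, (LinearEquiv.ofBijective (f.app a) (hf a)).finrank_eq]

/-- The subrepresentation given by a stable family of subspaces. -/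
def Rep.sub (M : Rep k Γ) (P : ∀ a, Submodule k (M.obj a))
    (hP : ∀ a b (h : Γ.Adj a b), ∀ x ∈ P a, M.map h x ∈ P b) : Rep k Γ where
  obj a := P a
  map {a b} h := (M.map h).restrict (hP a b h)

lemma Rep.isomorphic_directSum_sub (M : Rep k Γ) (P Q : ∀ a, Submodule k (M.obj a)) (hP hQ)
    (hc : ∀ a, IsCompl (P a) (Q a)) :
    M.Isomorphic ((M.sub P hP).directSum (M.sub Q hQ)) := by
  refine Rep.Isomorphic.symm
    ⟨{ app := fun a => (Submodule.prodEquivOfIsCompl _ _ (hc a)).toLinearMap,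
       comm := fun h => LinearMap.ext fun x => ?_ },
      fun a => (Submodule.prodEquivOfIsCompl _ _ (hc a)).bijective⟩
  exact (map_add (M.map h) (Subtype.val (p := (· ∈ P _)) x.1)
    (Subtype.val (p := (· ∈ Q _)) x.2)).symm

lemma Rep.Indecomposable.eq_bot_or_eq_bot {M : Rep k Γ} (hM : M.Indecomposable)
    (P Q : ∀ a, Submodule k (M.obj a))
    (hP : ∀ a b (h : Γ.Adj a b), ∀ x ∈ P a, M.map h x ∈ P b)
    (hQ : ∀ a b (h : Γ.Adj a b), ∀ x ∈ Q a, M.map h x ∈ Q b)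
    (hc : ∀ a, IsCompl (P a) (Q a)) : (∀ a, P a = ⊥) ∨ (∀ a, Q a = ⊥) := by
  rcases hM.2 _ _ (M.isomorphic_directSum_sub P Q hP hQ hc) with h | h
  · exact Or.inl fun a => (Submodule.subsingleton_iff_eq_bot).1 (h a)
  · exact Or.inr fun a => (Submodule.subsingleton_iff_eq_bot).1 (h a)

/-- A representation with only scalar endomorphisms is indecomposable. -/
theorem Rep.indecomposable_of_finrank_homSpace {M : Rep k Γ}
    (hM : Module.finrank k (homSpace M M) = 1) : M.Indecomposable := by
  have hnz : ¬ M.IsZero := by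
    intro h0
    have : Subsingleton (homSpace M M) := by
      refine ⟨fun f g => Subtype.ext (funext fun a => LinearMap.ext fun x => ?_)⟩
      have := h0 a
      exact Subsingleton.elim _ _
    rw [Module.finrank_zero_of_subsingleton] at hM
    exact zero_ne_one hM
  refine ⟨hnz, ?_⟩
  rintro A B ⟨f, hf⟩
  let e : ∀ a, M.obj a ≃ₗ[k] (A.obj a × B.obj a) := fun a =>
    LinearEquiv.ofBijective (f.app a) (hf a)
  have he : ∀ a b (h : Γ.Adj a b) x,
      e b (M.map h x) = (A.map h (e a x).1, B.map h (e a x).2) := fun a b h x =>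
    LinearMap.congr_fun (f.comm h) x
  -- The projection to `A` must be a scalar `c`. A nonzero vector of `B` forces c = 0, and then
  -- every vector of `A` is zero.
  let p : homSpace M M := ⟨fun a => (e a).symm.toLinearMap ∘ₗ LinearMap.inl k _ _ ∘ₗ
    LinearMap.fst k _ _ ∘ₗ (e a).toLinearMap, mem_homSpace.2 fun a b h x => by
      apply (e b).injective
      simp [he]⟩
  let one : homSpace M M := ⟨fun a => LinearMap.id, mem_homSpace.2 fun a b h x => rfl⟩
  have hone : one ≠ 0 := by
    intro h0
    refine hnz fun a => ⟨fun x y => ?_⟩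
    have h1 : ∀ x : M.obj a, x = 0 := fun x =>
      LinearMap.congr_fun (congrFun (congrArg Subtype.val h0) a) x
    rw [h1 x, h1 y]
  obtain ⟨c, hc⟩ := (finrank_eq_one_iff_of_nonzero' one hone).1 hM p
  have hcx : ∀ a (x : M.obj a), c • x = (e a).symm ((e a x).1, 0) := fun a x =>
    LinearMap.congr_fun (congrFun (congrArg Subtype.val hc) a) x
  by_contra! hcon
  simp only [Rep.IsZero, not_forall] at hcon
  obtain ⟨⟨a, ha⟩, ⟨b, hb⟩⟩ := hcon
  rw [not_subsingleton_iff_nontrivial] at ha hb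
  obtain ⟨x, hx⟩ := exists_ne (0 : A.obj a)
  obtain ⟨y, hy⟩ := exists_ne (0 : B.obj b)
  have h1 := congrArg (e a) (hcx a ((e a).symm (x, 0)))
  have h2 := congrArg (e b) (hcx b ((e b).symm (0, y)))
  simp only [map_smul, LinearEquiv.apply_symm_apply, Prod.smul_mk, Prod.mk.injEq, smul_zero,
    and_true, true_and, smul_eq_zero] at h1 h2
  rcases h2 with h2 | h2
  · rw [h2, zero_smul] at h1
    exact hx h1.symm
  · exact hy h2

end Indecomposable

/-! ### Representations at a sink or a source -/

section SinkSource

variable {V : Type v} [Fintype V] [DecidableEq V] {k : Type u} [Field k] {Γ : Digraph V}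

open Classical in
/-- The sum of the maps along all arrows ending at `i`. -/
noncomputable def Rep.inMap (M : Rep k Γ) (i : V) : (∀ a, M.obj a) →ₗ[k] M.obj i :=
  ∑ a, if h : Γ.Adj a i then M.map h ∘ₗ LinearMap.proj a else 0

open Classical in
omit [DecidableEq V] in
lemma Rep.inMap_apply (M : Rep k Γ) (i : V) (x : ∀ a, M.obj a) :
    M.inMap i x = ∑ a, if h : Γ.Adj a i then M.map h (x a) else 0 := by
  rw [Rep.inMap, LinearMap.sum_apply]
  refine Finset.sum_congr rfl fun a _ => ?_
  split_ifs <;> rfl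

lemma Rep.inMap_single (M : Rep k Γ) {i a : V} (h : Γ.Adj a i) (x : M.obj a) :
    M.inMap i (Pi.single a x) = M.map h x := by
  classical
  rw [Rep.inMap_apply, Finset.sum_eq_single a]
  · simp [h]
  · intro b _ hb
    simp [Pi.single_eq_of_ne hb]
  · simp

omit [DecidableEq V] in
lemma Rep.inMap_congr (M : Rep k Γ) {i : V} {x y : ∀ a, M.obj a}
    (h : ∀ a, Γ.Adj a i → x a = y a) : M.inMap i x = M.inMap i y := by
  classical
  rw [Rep.inMap_apply, Rep.inMap_apply]
  refine Finset.sum_congr rfl fun a _ => ?_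
  split_ifs with ha
  · rw [h a ha]
  · rfl

omit [DecidableEq V] in
lemma inMap_hom {M N : Rep k Γ} {f : ∀ a, M.obj a →ₗ[k] N.obj a} {i : V}
    (hf : ∀ a (h : Γ.Adj a i) x, f i (M.map h x) = N.map h (f a x)) (x : ∀ a, M.obj a) :
    f i (M.inMap i x) = N.inMap i fun a => f a (x a) := by
  classical
  rw [Rep.inMap_apply, Rep.inMap_apply, map_sum]
  refine Finset.sum_congr rfl fun a _ => ?_
  split_ifs with ha
  · exact hf a ha _
  · simp

/-- The vertex space at `i` is spanned by the images of the arrows ending at `i`. -/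
def Rep.IsFull (M : Rep k Γ) (i : V) : Prop := Function.Surjective (M.inMap i)

/-- The vertex space at `i` embeds into its images under the arrows starting at `i`. -/
def Rep.IsCofull (M : Rep k Γ) (i : V) : Prop :=
  ∀ x : M.obj i, (∀ j (h : Γ.Adj i j), M.map h x = 0) → x = 0

lemma Rep.dimVec_eq_single_one {M : Rep k Γ} {G : SimpleGraph V} (hq : titsForm G M.dimVec = 2)
    {i : V} (h : ∀ a, a ≠ i → Subsingleton (M.obj a)) : M.dimVec = Pi.single i 1 := by
  have h1 : M.dimVec = Pi.single i (M.dimVec i) := by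
    funext a
    by_cases ha : a = i
    · subst ha; simp
    · have := h a ha
      rw [M.dimVec_eq_zero, Pi.single_eq_of_ne ha]
  rw [h1, titsForm_single] at hq
  have h2 := M.dimVec_nonneg i
  simp only [Pi.zero_apply] at h2
  have h3 : M.dimVec i = 1 := by nlinarith
  rw [h1, h3]

/-- A complement of the image of the incoming arrows is a subrepresentation concentrated at the sink
`i`, and it splits off. So either it is zero, or `M` is concentrated at `i`, which the norm 2 turns
into the excluded dimension vector. -/
lemma Rep.Indecomposable.isFull {M : Rep k Γ} (hM : M.Indecomposable) {i : V}
    (hi : ∀ j, ¬ Γ.Adj i j) {G : SimpleGraph V} (hq : titsForm G M.dimVec = 2)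
    (hne : M.dimVec ≠ Pi.single i 1) : M.IsFull i := by
  obtain ⟨C, hC⟩ := Submodule.exists_isCompl (LinearMap.range (M.inMap i))
  refine (hM.eq_bot_or_eq_bot
    (Function.update (fun _ => ⊤) i (LinearMap.range (M.inMap i)))
    (Function.update (fun _ => ⊥) i C) ?_ ?_ ?_).elim (fun h => ?_) fun h => ?_
  · intro a b h x _
    by_cases hb : b = i
    · subst hb
      rw [Function.update_self]
      exact ⟨Pi.single a x, M.inMap_single h x⟩
    · rw [Function.update_of_ne hb]
      trivial
  · intro a b h x hx
    by_cases ha : a = i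
    · exact absurd (ha ▸ h) (hi b)
    · rw [Function.update_of_ne ha, Submodule.mem_bot] at hx
      rw [hx, map_zero]
      exact Submodule.zero_mem _
  · intro a
    by_cases ha : a = i
    · subst ha
      simpa using hC
    · rw [Function.update_of_ne ha, Function.update_of_ne ha]
      exact isCompl_top_bot
  · refine absurd (M.dimVec_eq_single_one hq fun a ha => ?_) hne
    have := h a
    rw [Function.update_of_ne ha] at this
    exact (Submodule.subsingleton_iff k).1 (subsingleton_of_bot_eq_top this.symm)
  · have := h i
    rw [Function.update_self] at this
    rw [this] at hC
    exact LinearMap.range_eq_top.1 (by simpa using hC.sup_eq_top)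

/-- Dual argument: at a source, the common kernel of the outgoing arrows splits off. -/
lemma Rep.Indecomposable.isCofull {M : Rep k Γ} (hM : M.Indecomposable) {i : V}
    (hi : ∀ j, ¬ Γ.Adj j i) {G : SimpleGraph V} (hq : titsForm G M.dimVec = 2)
    (hne : M.dimVec ≠ Pi.single i 1) : M.IsCofull i := by
  let K : Submodule k (M.obj i) := ⨅ j, ⨅ h : Γ.Adj i j, LinearMap.ker (M.map h)
  have hK : ∀ x, x ∈ K ↔ ∀ j (h : Γ.Adj i j), M.map h x = 0 := fun x => by
    simp [K, Submodule.mem_iInf]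
  obtain ⟨C, hC⟩ := Submodule.exists_isCompl K
  refine (hM.eq_bot_or_eq_bot (Function.update (fun _ => ⊥) i K)
    (Function.update (fun _ => ⊤) i C) ?_ ?_ ?_).elim (fun h => ?_) fun h => ?_
  · intro a b h x hx
    by_cases ha : a = i
    · subst ha
      rw [Function.update_self, hK] at hx
      rw [hx b h]
      exact Submodule.zero_mem _
    · rw [Function.update_of_ne ha, Submodule.mem_bot] at hx
      rw [hx, map_zero]
      exact Submodule.zero_mem _
  · intro a b h x _
    by_cases hb : b = i
    · exact absurd (hb ▸ h) (hi a)
    · rw [Function.update_of_ne hb]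
      trivial
  · intro a
    by_cases ha : a = i
    · subst ha
      simpa using hC
    · rw [Function.update_of_ne ha, Function.update_of_ne ha]
      exact isCompl_bot_top
  · intro x hx
    have := h i
    rw [Function.update_self] at this
    rw [← hK, this] at hx
    exact hx
  · refine absurd (M.dimVec_eq_single_one hq fun a ha => ?_) hne
    have := h a
    rw [Function.update_of_ne ha] at this
    exact (Submodule.subsingleton_iff k).1 (subsingleton_of_bot_eq_top this.symm)

end SinkSource

/-! ### Reflections of representations -/

section Reflection

variable {V : Type v} [Fintype V] {k : Type u} [Field k] {Γ Γ' : Digraph V} {i : V}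

/-- The representations `M` of `Γ` and `M'` of `Γ'` correspond to each other under the reflection
functors at the sink `i` of `Γ`: away from `i` they are identified, and at `i` there is a short
exact sequence `0 → M'_i → ⨁ M_j → M_i → 0`. -/
structure ReflectionData (i : V) (M : Rep k Γ) (M' : Rep k Γ') where
  e : ∀ a, M'.obj a →ₗ[k] M.obj a
  bij : ∀ a, a ≠ i → Function.Bijective (e a)
  comm : ∀ a b (h : Γ.Adj a b) (h' : Γ'.Adj a b), a ≠ i → b ≠ i →
    ∀ x, e b (M'.map h' x) = M.map h (e a x)
  full : M.IsFull i
  cofull : M'.IsCofull i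
  exact : ∀ x : ∀ a, M.obj a, M.inMap i x = 0 ↔
    ∃ y : M'.obj i, ∀ j (h : Γ'.Adj i j), x j = e j (M'.map h y)

/-- The new space at `i` is the kernel `K` of ⨁ M_j → M_i, cut out of families over all vertices by
requiring zeros off the neighbours of `i`. -/
lemma exists_reflection (h : IsSinkReflection Γ Γ' i) {M : Rep k Γ} (hM : M.IsFull i) :
    ∃ M' : Rep k Γ', Nonempty (ReflectionData i M M') := by
  classical
  let K : Submodule k (∀ a, M.obj a) :=
    LinearMap.ker (M.inMap i) ⊓ ⨅ a, ⨅ _ : ¬ Γ.Adj a i, LinearMap.ker (LinearMap.proj a)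
  have hK : ∀ x, x ∈ K ↔ M.inMap i x = 0 ∧ ∀ a, ¬ Γ.Adj a i → x a = 0 := fun x => by
    simp [K, Submodule.mem_iInf]
  -- All vertex spaces are replaced by coordinate spaces. This brings `K` from `Type (max u v)` into
  -- `Type u`, and confines the case distinction at `i` to a dimension.
  let n : V → ℕ := fun a => if a = i then Module.finrank k K else Module.finrank k (M.obj a)
  have hp : ∀ a, ∃ p : (Fin (n a) → k) →ₗ[k] (∀ a, M.obj a),
      a = i → Function.Injective p ∧ LinearMap.range p = K := by
    intro a
    by_cases ha : a = i
    · let φ : (Fin (n a) → k) ≃ₗ[k] K := LinearEquiv.ofFinrankEq _ _ (by simp [n, ha])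
      refine ⟨K.subtype ∘ₗ φ.toLinearMap, fun _ => ⟨?_, ?_⟩⟩
      · exact Subtype.val_injective.comp φ.injective
      · rw [LinearMap.range_comp, LinearEquiv.range, Submodule.map_top, Submodule.range_subtype]
    · exact ⟨0, fun h => absurd h ha⟩
  have he : ∀ a, ∃ (e : (Fin (n a) → k) →ₗ[k] M.obj a) (g : M.obj a →ₗ[k] (Fin (n a) → k)),
      a ≠ i → Function.Bijective e ∧ ∀ x, e (g x) = x := by
    intro a
    by_cases ha : a = i
    · exact ⟨0, 0, fun h => absurd ha h⟩
    · let φ : (Fin (n a) → k) ≃ₗ[k] M.obj a := LinearEquiv.ofFinrankEq _ _ (by simp [n, ha])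
      exact ⟨φ.toLinearMap, φ.symm.toLinearMap, fun _ => ⟨φ.bijective, φ.apply_symm_apply⟩⟩
  choose p hp using hp
  choose e g he using he
  let M' : Rep k Γ' :=
    { obj := fun a => Fin (n a) → k
      map := fun {a b} _ =>
        if a = i then g b ∘ₗ LinearMap.proj b ∘ₗ p a
        else if hab : Γ.Adj a b then g b ∘ₗ M.map hab ∘ₗ e a else 0 }
  have hmi : ∀ b (h' : Γ'.Adj i b) y, e b (M'.map h' y) = p i y b := by
    intro b h' y
    have hb : b ≠ i := fun hb => h.source i (hb ▸ h')
    simp only [M', if_true]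
    exact (he b hb).2 _
  have hpK : ∀ y, p i y ∈ K := fun y => by
    rw [← (hp i rfl).2]
    exact ⟨y, rfl⟩
  refine ⟨M', ⟨⟨e, fun a ha => (he a ha).1, ?_, hM, ?_, ?_⟩⟩⟩
  · intro a b hab h' ha hb x
    simp only [M', if_neg ha, dif_pos hab]
    exact (he b hb).2 _
  · intro y hy
    refine (hp i rfl).1 ?_
    rw [map_zero]
    funext j
    by_cases hj : Γ.Adj j i
    · have h' := (h.adj_iff j).2 hj
      rw [← hmi j h', hy j h', map_zero]
      rfl
    · exact ((hK _).1 (hpK y)).2 j hj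
  · intro x
    constructor
    · intro hx
      have : (fun j => if Γ.Adj j i then x j else 0) ∈ K := by
        refine (hK _).2 ⟨?_, fun a ha => if_neg ha⟩
        rw [← hx]
        exact M.inMap_congr fun a ha => if_pos ha
      rw [← (hp i rfl).2] at this
      obtain ⟨y, hy⟩ := this
      refine ⟨y, fun j h' => ?_⟩
      rw [hmi, hy]
      exact (if_pos ((h.adj_iff j).1 h')).symm
    · rintro ⟨y, hy⟩
      rw [← ((hK _).1 (hpK y)).1]
      refine M.inMap_congr fun a ha => ?_
      rw [hy a ((h.adj_iff a).2 ha), hmi]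

lemma exists_reflection_symm (h : IsSinkReflection Γ Γ' i) {M' : Rep k Γ'} (hM : M'.IsCofull i) :
    ∃ M : Rep k Γ, Nonempty (ReflectionData i M M') := by
  classical
  -- Components at vertices not joined to `i` are unrestricted, so the quotient by `K` is exactly
  -- the cokernel of M'_i → ⨁ M'_j over the neighbours.
  let K : Submodule k (∀ a, M'.obj a) :=
    { carrier := {x | ∃ y : M'.obj i, ∀ j (h : Γ'.Adj i j), x j = M'.map h y}
      zero_mem' := ⟨0, fun j h => by simp⟩
      add_mem' := by
        rintro x x' ⟨y, hy⟩ ⟨y', hy'⟩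
        exact ⟨y + y', fun j h => by rw [map_add, ← hy, ← hy']; rfl⟩
      smul_mem' := by
        rintro c x ⟨y, hy⟩
        exact ⟨c • y, fun j h => by rw [map_smul, ← hy]; rfl⟩ }
  have hK : ∀ x, x ∈ K ↔ ∃ y : M'.obj i, ∀ j (h : Γ'.Adj i j), x j = M'.map h y :=
    fun x => Iff.rfl
  let n : V → ℕ := fun a =>
    if a = i then Module.finrank k ((∀ a, M'.obj a) ⧸ K) else Module.finrank k (M'.obj a)
  have hp : ∀ a, ∃ p : (∀ a, M'.obj a) →ₗ[k] (Fin (n a) → k),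
      a = i → Function.Surjective p ∧ LinearMap.ker p = K := by
    intro a
    by_cases ha : a = i
    · let φ : ((∀ a, M'.obj a) ⧸ K) ≃ₗ[k] (Fin (n a) → k) :=
        LinearEquiv.ofFinrankEq _ _ (by simp [n, ha])
      refine ⟨φ.toLinearMap ∘ₗ K.mkQ, fun _ => ⟨?_, ?_⟩⟩
      · exact φ.surjective.comp K.mkQ_surjective
      · rw [LinearEquiv.ker_comp, Submodule.ker_mkQ]
    · exact ⟨0, fun h => absurd h ha⟩
  have he : ∀ a, ∃ (e : M'.obj a →ₗ[k] (Fin (n a) → k)) (g : (Fin (n a) → k) →ₗ[k] M'.obj a),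
      a ≠ i → Function.Bijective e ∧ (∀ x, e (g x) = x) ∧ ∀ x, g (e x) = x := by
    intro a
    by_cases ha : a = i
    · exact ⟨0, 0, fun h => absurd ha h⟩
    · let φ : M'.obj a ≃ₗ[k] (Fin (n a) → k) := LinearEquiv.ofFinrankEq _ _ (by simp [n, ha])
      exact ⟨φ.toLinearMap, φ.symm.toLinearMap,
        fun _ => ⟨φ.bijective, φ.apply_symm_apply, φ.symm_apply_apply⟩⟩
  choose p hp using hp
  choose e g he using he
  let M : Rep k Γ :=
    { obj := fun a => Fin (n a) → k
      map := fun {a b} _ =>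
        if b = i then p b ∘ₗ LinearMap.single k M'.obj a ∘ₗ g a
        else if hab : Γ'.Adj a b then e b ∘ₗ M'.map hab ∘ₗ g a else 0 }
  have hin : ∀ x : ∀ a, M.obj a,
      M.inMap i x = p i (fun a => if Γ.Adj a i then g a (x a) else 0) := by
    intro x
    have h1 : (fun a => if Γ.Adj a i then g a (x a) else 0) =
        ∑ a, Pi.single a (if Γ.Adj a i then g a (x a) else 0) :=
      (Finset.univ_sum_single _).symm
    rw [h1, map_sum, Rep.inMap_apply]
    refine Finset.sum_congr rfl fun a _ => ?_
    split_ifs with ha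
    · simp only [M, if_true]
      rfl
    · rw [Pi.single_zero, map_zero]
  have hne : ∀ a, Γ.Adj a i → a ≠ i := fun a ha hai => h.sink i (hai ▸ ha)
  have hker : ∀ x, p i x = 0 ↔ x ∈ K := fun x => by rw [← (hp i rfl).2, LinearMap.mem_ker]
  refine ⟨M, ⟨⟨e, fun a ha => (he a ha).1, ?_, ?_, hM, ?_⟩⟩⟩
  · intro a b hab h' ha hb x
    simp only [M, if_neg hb, dif_pos h']
    change _ = e b (M'.map h' (g a (e a x)))
    rw [(he a ha).2.2]
  · intro z
    obtain ⟨t, rfl⟩ := (hp i rfl).1 z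
    refine ⟨fun a => e a (t a), ?_⟩
    rw [hin, ← sub_eq_zero, ← map_sub, hker]
    refine ⟨0, fun j h' => ?_⟩
    have hj := (h.adj_iff j).1 h'
    rw [Pi.sub_apply, if_pos hj, (he j (hne j hj)).2.2, sub_self, map_zero]
  · intro x
    rw [hin, hker, hK]
    refine exists_congr fun y => forall_congr' fun j => forall_congr' fun h' => ?_
    have hj := (h.adj_iff j).1 h'
    rw [if_pos hj]
    constructor
    · intro hx
      rw [← hx, (he j (hne j hj)).2.1]
    · intro hx
      rw [hx, (he j (hne j hj)).2.2]

namespace ReflectionData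

variable {M N : Rep k Γ} {M' N' : Rep k Γ'}

/-- Corresponding homomorphisms, one way. -/
lemma exists_hom (h : IsSinkReflection Γ Γ' i) (R : ReflectionData i M M')
    (S : ReflectionData i N N') {f : ∀ a, M.obj a →ₗ[k] N.obj a} (hf : f ∈ homSpace M N) :
    ∃ f' ∈ homSpace M' N', ∀ a, a ≠ i → ∀ x, S.e a (f' a x) = f a (R.e a x) := by
  classical
  rw [mem_homSpace] at hf
  have hne : ∀ a, Γ'.Adj i a → a ≠ i := fun a ha hai => h.source i (hai ▸ ha)
  have key : ∀ a, ∃ f' : M'.obj a →ₗ[k] N'.obj a,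
      (a ≠ i → ∀ x, S.e a (f' x) = f a (R.e a x)) ∧
      (a = i → ∀ y j (h : Γ'.Adj a j), S.e j (N'.map h (f' y)) = f j (R.e j (M'.map h y))) := by
    intro a
    by_cases ha : a = i
    · subst ha
      let ψ : N'.obj a →ₗ[k] (∀ b, N.obj b) :=
        LinearMap.pi fun b => if hb : Γ'.Adj a b then S.e b ∘ₗ N'.map hb else 0
      let χ : M'.obj a →ₗ[k] (∀ b, N.obj b) :=
        LinearMap.pi fun b => if hb : Γ'.Adj a b then f b ∘ₗ R.e b ∘ₗ M'.map hb else 0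
      have hψ : ∀ y b (hb : Γ'.Adj a b), ψ y b = S.e b (N'.map hb y) := fun y b hb => by
        simp [ψ, hb]
      have hχ : ∀ y b (hb : Γ'.Adj a b), χ y b = f b (R.e b (M'.map hb y)) := fun y b hb => by
        simp [χ, hb]
      have hψi : LinearMap.ker ψ = ⊥ := by
        rw [LinearMap.ker_eq_bot']
        intro y hy
        refine S.cofull y fun j hj => (S.bij j (hne j hj)).1 ?_
        rw [← hψ, hy, map_zero]
        rfl
      -- The component at the vertex has to be ψ⁻¹ ∘ χ, the map induced on kernels. A linear left
      -- inverse supplies it once χ is seen to land in the range of ψ, which holds because `f`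
      -- commutes with the incoming arrows.
      obtain ⟨r, hr⟩ := ψ.exists_leftInverse_of_injective hψi
      refine ⟨r ∘ₗ χ, fun ha => absurd rfl ha, fun _ y j hj => ?_⟩
      have h0 : N.inMap a (χ y) = 0 := by
        have h1 : M.inMap a (fun b => if hb : Γ'.Adj a b then R.e b (M'.map hb y) else 0) = 0 :=
          (R.exact _).2 ⟨y, fun j hj => by simp [hj]⟩
        have h2 := inMap_hom (i := a) (fun b hb x => hf b a hb x)
          (fun b => if hb : Γ'.Adj a b then R.e b (M'.map hb y) else 0)
        rw [h1, map_zero] at h2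
        rw [h2]
        refine N.inMap_congr fun b hb => ?_
        have hb' := (h.adj_iff b).2 hb
        rw [hχ y b hb', dif_pos hb']
      obtain ⟨y', hy'⟩ := (S.exact _).1 h0
      have h3 : ψ y' = χ y := by
        funext b
        by_cases hb : Γ'.Adj a b
        · rw [hψ y' b hb, hy' b hb]
        · simp [ψ, χ, hb]
      have h4 : r (χ y) = y' := by
        rw [← h3]
        exact LinearMap.congr_fun hr y'
      rw [LinearMap.comp_apply, h4, ← hψ, h3, hχ]
    · let φ := LinearEquiv.ofBijective (S.e a) (S.bij a ha)
      refine ⟨φ.symm.toLinearMap ∘ₗ f a ∘ₗ R.e a, fun _ x => ?_, fun h => absurd h ha⟩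
      exact φ.apply_symm_apply _
  choose f' h1 h2 using key
  refine ⟨f', mem_homSpace.2 fun a b hab x => ?_, h1⟩
  have hb : b ≠ i := fun hb => h.source a (hb ▸ hab)
  refine (S.bij b hb).1 ?_
  rw [h1 b hb]
  by_cases ha : a = i
  · rw [h2 a ha]
  · have hab' := (h.adj_iff_of_ne a b ha hb).1 hab
    rw [S.comm a b hab' hab ha hb, R.comm a b hab' hab ha hb, h1 a ha, hf]

/-- Corresponding homomorphisms, the other way. -/
lemma exists_hom_symm (h : IsSinkReflection Γ Γ' i) (R : ReflectionData i M M')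
    (S : ReflectionData i N N') {f' : ∀ a, M'.obj a →ₗ[k] N'.obj a} (hf : f' ∈ homSpace M' N') :
    ∃ f ∈ homSpace M N, ∀ a, a ≠ i → ∀ x, S.e a (f' a x) = f a (R.e a x) := by
  classical
  rw [mem_homSpace] at hf
  have hne : ∀ a, Γ.Adj a i → a ≠ i := fun a ha hai => h.sink i (hai ▸ ha)
  have key : ∀ a, ∃ F : M.obj a →ₗ[k] N.obj a, a ≠ i → ∀ x, S.e a (f' a x) = F (R.e a x) := by
    intro a
    by_cases ha : a = i
    · exact ⟨0, fun h => absurd ha h⟩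
    · let φ := LinearEquiv.ofBijective (R.e a) (R.bij a ha)
      refine ⟨S.e a ∘ₗ f' a ∘ₗ φ.symm.toLinearMap, fun _ x => ?_⟩
      have : φ.symm (R.e a x) = x := φ.symm_apply_apply x
      simp [this]
  choose F hF using key
  let Φ : (∀ a, M.obj a) →ₗ[k] (∀ a, N.obj a) := LinearMap.pi fun a => F a ∘ₗ LinearMap.proj a
  have hΦ : ∀ x a, Φ x a = F a (x a) := fun x a => rfl
  have hwd : ∀ x, M.inMap i x = 0 → N.inMap i (Φ x) = 0 := by
    intro x hx
    obtain ⟨y, hy⟩ := (R.exact x).1 hx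
    refine (S.exact _).2 ⟨f' i y, fun j hj => ?_⟩
    have hji := hne j ((h.adj_iff j).1 hj)
    rw [hΦ, hy j hj, ← hF j hji, hf]
  -- The component at `i` is the map induced on cokernels, written with a linear section; `hwd`
  -- makes the choice of section irrelevant.
  obtain ⟨s, hs⟩ := (M.inMap i).exists_rightInverse_of_surjective (LinearMap.range_eq_top.2 R.full)
  have hs' : ∀ x, M.inMap i (s x) = x := fun x => LinearMap.congr_fun hs x
  have key2 : ∀ a, ∃ f : M.obj a →ₗ[k] N.obj a, (a ≠ i → f = F a) ∧
      (a = i → ∀ b (hb : Γ.Adj b a) x, f (M.map hb x) = N.map hb (F b x)) := by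
    intro a
    by_cases ha : a = i
    · subst ha
      refine ⟨N.inMap a ∘ₗ Φ ∘ₗ s, fun h => absurd rfl h, fun _ b hb x => ?_⟩
      have h1 := hwd (s (M.map hb x) - Pi.single b x) (by
        rw [map_sub, hs', M.inMap_single hb, sub_self])
      rw [map_sub, map_sub, sub_eq_zero] at h1
      rw [LinearMap.comp_apply, LinearMap.comp_apply, h1, ← N.inMap_single hb]
      refine N.inMap_congr fun c _ => ?_
      rw [hΦ]
      by_cases hc : c = b
      · subst hc; simp
      · rw [Pi.single_eq_of_ne hc, Pi.single_eq_of_ne hc, map_zero]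
    · exact ⟨F a, fun _ => rfl, fun h => absurd h ha⟩
  choose f h1 h2 using key2
  refine ⟨f, mem_homSpace.2 fun a b hab x => ?_, fun a ha x => by rw [h1 a ha, hF a ha]⟩
  have ha : a ≠ i := fun ha => h.sink b (ha ▸ hab)
  by_cases hb : b = i
  · rw [h2 b hb, h1 a ha]
  · rw [h1 a ha, h1 b hb]
    obtain ⟨y, rfl⟩ := (R.bij a ha).2 x
    have hab' := (h.adj_iff_of_ne a b ha hb).2 hab
    rw [← R.comm a b hab hab' ha hb, ← hF b hb, ← hF a ha, hf, S.comm a b hab hab' ha hb]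

/-- A morphism is determined by its components off `i`: over Γ because `M` is generated at `i` by
its neighbours, over Γ' because `N'` embeds at `i` into its neighbours. -/
lemma hom_eq_zero_iff (h : IsSinkReflection Γ Γ' i) (R : ReflectionData i M M')
    (S : ReflectionData i N N') {f : ∀ a, M.obj a →ₗ[k] N.obj a} (hf : f ∈ homSpace M N)
    {f' : ∀ a, M'.obj a →ₗ[k] N'.obj a} (hf' : f' ∈ homSpace M' N')
    (hff : ∀ a, a ≠ i → ∀ x, S.e a (f' a x) = f a (R.e a x)) : f = 0 ↔ f' = 0 := by
  rw [mem_homSpace] at hf hf'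
  constructor
  · intro h0
    have h1 : ∀ a, a ≠ i → f' a = 0 := fun a ha => LinearMap.ext fun x => (S.bij a ha).1 (by
      rw [hff a ha, h0, LinearMap.zero_apply, map_zero]
      rfl)
    funext a
    by_cases ha : a = i
    · subst ha
      refine LinearMap.ext fun y => S.cofull _ fun j hj => ?_
      rw [← hf', h1 j fun hja => h.source a (hja ▸ hj)]
      rfl
    · exact h1 a ha
  · intro h0
    have h1 : ∀ a, a ≠ i → f a = 0 := fun a ha => LinearMap.ext fun x => by
      obtain ⟨y, rfl⟩ := (R.bij a ha).2 x
      rw [← hff a ha, h0]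
      exact map_zero _
    funext a
    by_cases ha : a = i
    · subst ha
      refine LinearMap.ext fun z => ?_
      obtain ⟨x, rfl⟩ := R.full z
      rw [inMap_hom fun b hb x => hf b a hb x]
      have : N.inMap a (fun b => f b (x b)) = N.inMap a 0 := N.inMap_congr fun b hb => by
        rw [h1 b fun hba => h.sink a (hba ▸ hb)]
        rfl
      rw [this, map_zero]
      rfl
    · exact h1 a ha

/-- Reflections preserve the dimensions of spaces of homomorphisms. -/
theorem finrank_homSpace_eq (h : IsSinkReflection Γ Γ' i) (R : ReflectionData i M M')
    (S : ReflectionData i N N') :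
    Module.finrank k (homSpace M' N') = Module.finrank k (homSpace M N) := by
  -- The correspondence of morphisms is kept as a linear relation; both of its projections are
  -- bijective.
  let C : Submodule k (homSpace M N × homSpace M' N') :=
    { carrier := {p | ∀ a, a ≠ i → ∀ x, S.e a (p.2.1 a x) = p.1.1 a (R.e a x)}
      zero_mem' := fun a _ x => map_zero _
      add_mem' := fun {p q} hp hq a ha x => by
        have h1 := hp a ha x
        have h2 := hq a ha x
        change S.e a (p.2.1 a x + q.2.1 a x) = p.1.1 a (R.e a x) + q.1.1 a (R.e a x)
        rw [map_add, h1, h2]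
      smul_mem' := fun c p hp a ha x => by
        have h1 := hp a ha x
        change S.e a (c • p.2.1 a x) = c • p.1.1 a (R.e a x)
        rw [map_smul, h1] }
  have hC : ∀ p : C, (p.1.1 : ∀ a, M.obj a →ₗ[k] N.obj a) = 0 ↔
      (p.1.2 : ∀ a, M'.obj a →ₗ[k] N'.obj a) = 0 := fun p =>
    hom_eq_zero_iff h R S p.1.1.2 p.1.2.2 p.2
  have b1 : Function.Bijective (LinearMap.fst k _ _ ∘ₗ C.subtype) := by
    constructor
    · refine (injective_iff_map_eq_zero _).2 fun p hp => ?_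
      have h1 : (p.1.1 : ∀ a, M.obj a →ₗ[k] N.obj a) = 0 := congrArg Subtype.val hp
      exact Subtype.ext (Prod.ext hp (Subtype.ext ((hC p).1 h1)))
    · intro f
      obtain ⟨f', hf', hff⟩ := exists_hom h R S f.2
      exact ⟨⟨(f, ⟨f', hf'⟩), hff⟩, rfl⟩
  have b2 : Function.Bijective (LinearMap.snd k _ _ ∘ₗ C.subtype) := by
    constructor
    · refine (injective_iff_map_eq_zero _).2 fun p hp => ?_
      have h1 : (p.1.2 : ∀ a, M'.obj a →ₗ[k] N'.obj a) = 0 := congrArg Subtype.val hp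
      exact Subtype.ext (Prod.ext (Subtype.ext ((hC p).2 h1)) hp)
    · intro f'
      obtain ⟨f, hf, hff⟩ := exists_hom_symm h R S f'.2
      exact ⟨⟨(⟨f, hf⟩, f'), hff⟩, rfl⟩
  rw [← (LinearEquiv.ofBijective _ b1).finrank_eq, ← (LinearEquiv.ofBijective _ b2).finrank_eq]

open Classical in
/-- Reflections of representations act on dimension vectors by simple reflections. -/
theorem dimVec_add_dimVec (h : IsSinkReflection Γ Γ' i) (R : ReflectionData i M M') :
    M.dimVec i + M'.dimVec i = ∑ j, if Γ.Adj j i then M.dimVec j else 0 := by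
  -- The middle term of 0 → M'_i → X → M_i → 0, now over the neighbours alone so that dimensions can
  -- be counted.
  let X := ∀ a : {a // Γ.Adj a i}, M.obj a
  have : Fintype {a // Γ.Adj a i} := Fintype.ofFinite _
  let ext : X →ₗ[k] (∀ a, M.obj a) :=
    LinearMap.pi fun a => if ha : Γ.Adj a i then LinearMap.proj (⟨a, ha⟩ : {a // Γ.Adj a i}) else 0
  have hext : ∀ x a (ha : Γ.Adj a i), ext x a = x ⟨a, ha⟩ := fun x a ha => by
    simp only [ext, LinearMap.pi_apply, dif_pos ha]
    rfl
  let φ : X →ₗ[k] M.obj i := M.inMap i ∘ₗ ext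
  let ψ : M'.obj i →ₗ[k] X :=
    LinearMap.pi fun a => R.e a.1 ∘ₗ M'.map ((h.adj_iff a.1).2 a.2)
  have hφ : Function.Surjective φ := by
    intro z
    obtain ⟨x, rfl⟩ := R.full z
    exact ⟨fun a => x a.1, M.inMap_congr fun a ha => hext _ a ha⟩
  have hψ : Function.Injective ψ := by
    rw [← LinearMap.ker_eq_bot, LinearMap.ker_eq_bot']
    intro y hy
    refine R.cofull y fun j hj => ?_
    have hj' := (h.adj_iff j).1 hj
    refine (R.bij j fun hji => h.sink i (hji ▸ hj')).1 ?_
    rw [map_zero]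
    exact congrFun hy ⟨j, hj'⟩
  have hex : LinearMap.ker φ = LinearMap.range ψ := by
    ext x
    rw [LinearMap.mem_ker, LinearMap.comp_apply, R.exact, LinearMap.mem_range]
    refine exists_congr fun y => ?_
    constructor
    · intro hy
      funext a
      rw [← hext x a.1 a.2, hy a.1 ((h.adj_iff a.1).2 a.2)]
      rfl
    · rintro rfl j hj
      rw [hext _ j ((h.adj_iff j).1 hj)]
      rfl
  have h1 := φ.finrank_range_add_finrank_ker
  rw [LinearMap.range_eq_top.2 hφ, finrank_top, hex, LinearMap.finrank_range_of_inj hψ,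
    Module.finrank_pi_fintype] at h1
  rw [← Finset.sum_filter, Finset.sum_subtype (F := this) _ (by simp)]
  simp only [Rep.dimVec]
  exact_mod_cast h1

lemma dimVec_of_ne (R : ReflectionData i M M') {a : V} (ha : a ≠ i) :
    M'.dimVec a = M.dimVec a := by
  simp only [Rep.dimVec, (LinearEquiv.ofBijective (R.e a) (R.bij a ha)).finrank_eq]

theorem dimVec_eq [DecidableEq V] (h : IsSinkReflection Γ Γ' i) (R : ReflectionData i M M') :
    M'.dimVec = simpleReflection Γ.toSimpleGraphInclusive i M.dimVec := by
  funext a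
  by_cases ha : a = i
  · subst ha
    have := R.dimVec_add_dimVec h
    rw [h.simpleReflection_apply]
    linarith
  · rw [R.dimVec_of_ne ha, simpleReflection_apply_of_ne ha]

/-- Reflections reflect isomorphisms. -/
theorem isomorphic (h : IsSinkReflection Γ Γ' i) (R : ReflectionData i M M')
    (S : ReflectionData i N N') (hiso : M'.Isomorphic N') : M.Isomorphic N := by
  classical
  have hdim := hiso.dimVec_eq
  obtain ⟨F, hF⟩ := hiso
  obtain ⟨f, hf, hff⟩ := exists_hom_symm h R S (f' := F.app)
    (mem_homSpace.2 fun a b hab x => LinearMap.congr_fun (F.comm hab) x)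
  rw [mem_homSpace] at hf
  have hbij : ∀ a, a ≠ i → Function.Bijective (f a) := by
    intro a ha
    rw [← Function.Bijective.of_comp_iff _ (R.bij a ha)]
    have : f a ∘ R.e a = S.e a ∘ F.app a := funext fun x => (hff a ha x).symm
    rw [this]
    exact (S.bij a ha).comp (hF a)
  refine ⟨⟨f, fun {a b} hab => LinearMap.ext fun x => hf a b hab x⟩, fun a => ?_⟩
  by_cases ha : a = i
  · subst ha
    -- At the sink, surjectivity comes from `N` being generated by its neighbours. The two
    -- dimensions agree because each is fixed by the reflected dimension vector.
    have hsurj : Function.Surjective (f a) := by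
      intro z
      obtain ⟨x, rfl⟩ := S.full z
      have : ∀ b, ∃ t, b ≠ a → f b t = x b := fun b => by
        by_cases hb : b = a
        · exact ⟨0, fun h => absurd hb h⟩
        · obtain ⟨t, ht⟩ := (hbij b hb).2 (x b)
          exact ⟨t, fun _ => ht⟩
      choose t ht using this
      refine ⟨M.inMap a t, ?_⟩
      rw [inMap_hom fun b hb x => hf b a hb x]
      exact N.inMap_congr fun b hb => ht b fun hba => h.sink a (hba ▸ hb)
    have hd : Module.finrank k (M.obj a) = Module.finrank k (N.obj a) := by
      have h1 := R.dimVec_add_dimVec h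
      have h2 := S.dimVec_add_dimVec h
      have h3 : (∑ j, if Γ.Adj j a then M.dimVec j else 0) =
          ∑ j, if Γ.Adj j a then N.dimVec j else 0 := by
        refine Finset.sum_congr rfl fun j _ => ?_
        split_ifs with hj
        · have hja : j ≠ a := fun hja => h.sink a (hja ▸ hj)
          rw [← R.dimVec_of_ne hja, ← S.dimVec_of_ne hja, hdim]
        · rfl
      have h4 := congrFun hdim a
      have h5 : M.dimVec a = N.dimVec a := by linarith
      simp only [Rep.dimVec] at h5
      exact_mod_cast h5
    exact ⟨(LinearMap.injective_iff_surjective_of_finrank_eq_finrank hd).2 hsurj, hsurj⟩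
  · exact hbij a ha

lemma inMap_directSum (x : ∀ a, (M.directSum N).obj a) :
    (M.directSum N).inMap i x =
      (M.inMap i fun a => (x a).1, N.inMap i fun a => (x a).2) := by
  classical
  rw [Rep.inMap_apply, Rep.inMap_apply, Rep.inMap_apply]
  refine Prod.ext ?_ ?_
  · refine (Prod.fst_sum).trans (Finset.sum_congr rfl fun a _ => ?_)
    split_ifs <;> rfl
  · refine (Prod.snd_sum).trans (Finset.sum_congr rfl fun a _ => ?_)
    split_ifs <;> rfl

/-- The direct sum of corresponding pairs. -/
def directSum (R : ReflectionData i M M') (S : ReflectionData i N N') :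
    ReflectionData i (M.directSum N) (M'.directSum N') where
  e a := (R.e a).prodMap (S.e a)
  bij a ha := (R.bij a ha).prodMap (S.bij a ha)
  comm a b h h' ha hb x := Prod.ext (R.comm a b h h' ha hb x.1) (S.comm a b h h' ha hb x.2)
  full z := by
    obtain ⟨x, hx⟩ := R.full z.1
    obtain ⟨y, hy⟩ := S.full z.2
    exact ⟨fun a => (x a, y a), (inMap_directSum _).trans (Prod.ext hx hy)⟩
  cofull y hy := Prod.ext
    (R.cofull y.1 fun j hj => congrArg Prod.fst (hy j hj))
    (S.cofull y.2 fun j hj => congrArg Prod.snd (hy j hj))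
  exact x := by
    constructor
    · intro hx
      have hx' := (inMap_directSum x).symm.trans hx
      obtain ⟨y, hy⟩ := (R.exact _).1 (congrArg Prod.fst hx')
      obtain ⟨z, hz⟩ := (S.exact _).1 (congrArg Prod.snd hx')
      exact ⟨(y, z), fun j hj => Prod.ext (hy j hj) (hz j hj)⟩
    · rintro ⟨y, hy⟩
      refine (inMap_directSum x).trans (Prod.ext ?_ ?_)
      · exact (R.exact _).2 ⟨y.1, fun j hj => congrArg Prod.fst (hy j hj)⟩
      · exact (S.exact _).2 ⟨y.2, fun j hj => congrArg Prod.snd (hy j hj)⟩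

lemma isZero (h : IsSinkReflection Γ Γ' i) (R : ReflectionData i M M') (hM : M.IsZero) :
    M'.IsZero := by
  have h1 : ∀ a, a ≠ i → Subsingleton (M'.obj a) := fun a ha => by
    have := hM a
    exact (R.bij a ha).1.subsingleton
  intro a
  by_cases ha : a = i
  · subst ha
    refine subsingleton_of_forall_eq 0 fun y => R.cofull y fun j hj => ?_
    have := h1 j fun hja => h.source a (hja ▸ hj)
    exact Subsingleton.elim _ _
  · exact h1 a ha

/-- Reflections preserve indecomposability. -/
theorem indecomposable (h : IsSinkReflection Γ Γ' i) (R : ReflectionData i M M')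
    (hM : M.Indecomposable) : M'.Indecomposable := by
  constructor
  · intro h0
    refine hM.1 fun a => ?_
    have h1 : ∀ a, a ≠ i → Subsingleton (M.obj a) := fun a ha => by
      have := h0 a
      exact (R.bij a ha).2.subsingleton
    by_cases ha : a = i
    · subst ha
      refine subsingleton_of_forall_eq 0 fun z => ?_
      obtain ⟨x, rfl⟩ := R.full z
      have : M.inMap a x = M.inMap a 0 := M.inMap_congr fun b hb => by
        have := h1 b fun hba => h.sink a (hba ▸ hb)
        exact Subsingleton.elim _ _
      rw [this, map_zero]
    · exact h1 a ha
  · intro A' B' hiso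
    have hiso' := hiso
    obtain ⟨f, hf⟩ := hiso'.symm
    -- Being cofull passes to summands, so `A'` and `B'` can be reflected back. The sum of the
    -- results is isomorphic to `M`, whose indecomposability kills one of them.
    have hcof : (A'.directSum B').IsCofull i := by
      intro y hy
      refine (hf i).1 ?_
      rw [map_zero]
      refine R.cofull _ fun j hj => ?_
      have h1 := LinearMap.congr_fun (f.comm hj) y
      simp only [LinearMap.comp_apply] at h1
      rw [← h1, hy j hj, map_zero]
    obtain ⟨A, ⟨RA⟩⟩ := exists_reflection_symm h (M' := A') fun y hy =>
      congrArg Prod.fst (hcof (y, 0) fun j hj => Prod.ext (hy j hj) (map_zero (B'.map hj)))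
    obtain ⟨B, ⟨RB⟩⟩ := exists_reflection_symm h (M' := B') fun y hy =>
      congrArg Prod.snd (hcof (0, y) fun j hj => Prod.ext (map_zero (A'.map hj)) (hy j hj))
    rcases hM.2 A B (isomorphic h R (RA.directSum RB) hiso) with h0 | h0
    · exact Or.inl (RA.isZero h h0)
    · exact Or.inr (RB.isZero h h0)

end ReflectionData

end Reflection

/-! ### Gabriel's theorem -/

section Gabriel

variable {V : Type v} [Fintype V] [DecidableEq V] {k : Type u} [Field k] {Γ Γ' : Digraph V} {i : V}

lemma simpleReflection_simpleReflection (G : SimpleGraph V) (i : V) (x : V → ℤ) :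
    simpleReflection G i (simpleReflection G i x) = x := by
  have h : rootPairing G (simpleReflection G i x) i = -rootPairing G x i := by
    rw [simpleReflection_eq]
    simp only [rootPairing, neighborSum_add, neighborSum_single]
    simp
    ring
  rw [simpleReflection_eq i (simpleReflection G i x), h, simpleReflection_eq, add_assoc,
    ← Pi.single_add]
  simp

omit [Fintype V] [DecidableEq V] in
lemma IsSinkReflection.asymm (h : IsSinkReflection Γ Γ' i) (hΓ : ∀ a b, Γ.Adj a b → ¬ Γ.Adj b a)
    (a b : V) (hab : Γ'.Adj a b) : ¬ Γ'.Adj b a := by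
  have hb : b ≠ i := fun hb => h.source a (hb ▸ hab)
  intro hba
  have ha : a ≠ i := fun ha => h.source b (ha ▸ hba)
  exact hΓ a b ((h.adj_iff_of_ne a b ha hb).1 hab) ((h.adj_iff_of_ne b a hb ha).1 hba)

/-- There is a representation with dimension vector `x` and only scalar endomorphisms, and it
is the only indecomposable representation with this dimension vector. -/
def HasUniqueBrick (k : Type u) [Field k] (Γ : Digraph V) (x : V → ℤ) : Prop :=
  ∃ M : Rep k Γ, M.dimVec = x ∧ Module.finrank k (homSpace M M) = 1 ∧
    ∀ N : Rep k Γ, N.Indecomposable → N.dimVec = x → N.Isomorphic M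

/-- Without a loop at `i` every arrow acts as zero, so the dimension vector determines the
representation. It has no self-extensions, and the Euler form gives dim End = 1. -/
lemma hasUniqueBrick_single (k : Type u) [Field k] {Γ : Digraph V}
    (hΓ : ∀ a b, Γ.Adj a b → ¬ Γ.Adj b a) (i : V) : HasUniqueBrick k Γ (Pi.single i 1) := by
  classical
  let M : Rep k Γ := { obj := fun a => Fin (if a = i then 1 else 0) → k, map := fun _ => 0 }
  have hM : M.dimVec = Pi.single i 1 := by
    funext a
    by_cases ha : a = i
    · subst ha
      simp [Rep.dimVec, M]
    · simp [Rep.dimVec, M, ha]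
  have hsub : ∀ (N : Rep k Γ), N.dimVec = Pi.single i 1 → ∀ a, a ≠ i → Subsingleton (N.obj a) :=
    fun N hN a ha => Rep.subsingleton_of_dimVec (by rw [hN, Pi.single_eq_of_ne ha])
  have hcase : ∀ a b, Γ.Adj a b → a ≠ i ∨ b ≠ i := by
    intro a b hab
    by_contra! h
    rw [h.1, h.2] at hab
    exact hΓ i i hab hab
  refine ⟨M, hM, ?_, fun N _ hN => ?_⟩
  · have h1 := finrank_homSpace_sub_finrank_ext1 M M
    have h2 : Module.finrank k (Ext1 M M) = 0 := finrank_ext1_eq_zero_of_cocycle M M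
      fun a b hab => (hcase a b hab).imp (hsub M hM a) (hsub M hM b)
    have h3 : eulerForm Γ M.dimVec M.dimVec = 1 := by
      have := titsForm_eq_two_mul_eulerForm hΓ M.dimVec
      rw [hM, titsForm_single] at this
      rw [hM]
      linarith
    rw [h2, h3] at h1
    simp only [Nat.cast_zero, sub_zero] at h1
    exact_mod_cast h1
  · have he : ∀ a, Nonempty (N.obj a ≃ₗ[k] M.obj a) := fun a => by
      refine ⟨LinearEquiv.ofFinrankEq _ _ ?_⟩
      have : N.dimVec a = M.dimVec a := by rw [hN, hM]
      simp only [Rep.dimVec] at this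
      exact_mod_cast this
    let e : ∀ a, N.obj a ≃ₗ[k] M.obj a := fun a => (he a).some
    refine ⟨⟨fun a => (e a).toLinearMap, fun {a b} hab => LinearMap.ext fun x => ?_⟩,
      fun a => (e a).bijective⟩
    rcases hcase a b hab with h | h
    · have := hsub N hN a h
      rw [Subsingleton.elim x 0, map_zero, map_zero]
    · have := hsub M hM b h
      exact Subsingleton.elim _ _

/-- The brick M' over Γ' can be reflected back unless its dimension vector is α_i, which would mean
x = -α_i. Any indecomposable N of dimension x reflects to a copy of M', and reflection detects
isomorphism. -/
lemma IsSinkReflection.hasUniqueBrick (h : IsSinkReflection Γ Γ' i) {x : V → ℤ} (hx : 0 ≤ x)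
    (hq : titsForm Γ.toSimpleGraphInclusive x = 2) (hne : x ≠ Pi.single i 1)
    (hg : HasUniqueBrick k Γ' (simpleReflection Γ.toSimpleGraphInclusive i x)) :
    HasUniqueBrick k Γ x := by
  obtain ⟨M', hM', hend, huniq⟩ := hg
  have hcof : M'.IsCofull i := by
    refine (Rep.indecomposable_of_finrank_homSpace hend).isCofull h.source
      (G := Γ.toSimpleGraphInclusive) (by rw [hM', titsForm_simpleReflection, hq]) ?_
    rw [hM']
    intro h0
    have h1 := simpleReflection_simpleReflection Γ.toSimpleGraphInclusive i x
    rw [h0, simpleReflection_eq] at h1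
    have h2 := hx i
    rw [← h1] at h2
    simp [rootPairing, neighborSum_single] at h2
  obtain ⟨M, ⟨R⟩⟩ := exists_reflection_symm h hcof
  refine ⟨M, ?_, ?_, fun N hN hNx => ?_⟩
  · have h1 := R.dimVec_eq h
    rw [hM'] at h1
    rw [← simpleReflection_simpleReflection Γ.toSimpleGraphInclusive i M.dimVec, ← h1,
      simpleReflection_simpleReflection]
  · rw [← R.finrank_homSpace_eq h R, hend]
  · have hfull : N.IsFull i := hN.isFull h.sink (by rw [hNx, hq]) (by rw [hNx]; exact hne)
    obtain ⟨N', ⟨S⟩⟩ := exists_reflection h hfull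
    exact S.isomorphic h R (huniq N' (S.indecomposable h hN) (by rw [S.dimVec_eq h, hNx]))

/-- A counterexample is never the simple root about to be reflected, so it stays nonnegative and
stays a counterexample at each step. -/
lemma SinkSequence.not_hasUniqueBrick {l : List V} (hs : SinkSequence Γ l Γ')
    (hΓ : ∀ a b, Γ.Adj a b → ¬ Γ.Adj b a)
    (hpos : ∀ x, x ≠ 0 → 0 < titsForm Γ.toSimpleGraphInclusive x) {x : V → ℤ} (hx : 0 ≤ x)
    (hq : titsForm Γ.toSimpleGraphInclusive x = 2) (hn : ¬ HasUniqueBrick k Γ x) :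
    0 ≤ reflectList Γ.toSimpleGraphInclusive l x ∧
      titsForm Γ.toSimpleGraphInclusive (reflectList Γ.toSimpleGraphInclusive l x) = 2 ∧
      ¬ HasUniqueBrick k Γ' (reflectList Γ.toSimpleGraphInclusive l x) := by
  induction hs generalizing x with
  | nil Γ => exact ⟨hx, hq, hn⟩
  | cons h hl ih =>
    rename_i Γ₁ Γ₂ Γ₃ j l
    have hne : x ≠ Pi.single j 1 := fun h0 => hn (h0 ▸ hasUniqueBrick_single k hΓ j)
    have := ih (x := simpleReflection Γ₁.toSimpleGraphInclusive j x) (h.asymm hΓ)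
      (by rw [h.toSimpleGraph_eq]; exact hpos) (simpleReflection_nonneg hpos hx hq hne)
      (by rw [h.toSimpleGraph_eq, titsForm_simpleReflection, hq])
      fun hg => hn (h.hasUniqueBrick hx hq hne hg)
    rw [h.toSimpleGraph_eq] at this
    exact this

/-- Gabriel's theorem for a quiver with positive definite Tits form: for every positive root
there is exactly one indecomposable representation. -/
theorem hasUniqueBrick_of_titsForm (k : Type u) [Field k]
    (hΓ : ∀ a b, Γ.Adj a b → ¬ Γ.Adj b a)
    (hpos : ∀ x, x ≠ 0 → 0 < titsForm Γ.toSimpleGraphInclusive x) {x : V → ℤ} (hx : 0 ≤ x)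
    (hq : titsForm Γ.toSimpleGraphInclusive x = 2) : HasUniqueBrick k Γ x := by
  by_contra hn
  obtain ⟨l, hl, hmem, hs⟩ := exists_sinkSequence hΓ hpos
  obtain ⟨m, hm⟩ := exists_iterate_reflectList hpos hl hmem (x := x)
  have key : ∀ m, 0 ≤ (reflectList Γ.toSimpleGraphInclusive l)^[m] x ∧
      titsForm Γ.toSimpleGraphInclusive ((reflectList Γ.toSimpleGraphInclusive l)^[m] x) = 2 ∧
      ¬ HasUniqueBrick k Γ ((reflectList Γ.toSimpleGraphInclusive l)^[m] x) := by
    intro m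
    induction m with
    | zero => exact ⟨hx, hq, hn⟩
    | succ m ih =>
      rw [Function.iterate_succ_apply']
      exact hs.not_hasUniqueBrick hΓ hpos ih.1 ih.2.1 ih.2.2
  exact hm ⟨(key m).1, (key m).2.1⟩

end Gabriel

/-! ### Decorated quivers -/

section DecoratedQuiver

variable {I : Type v} {Γ : Digraph I}

lemma IsDynkinQuiver.decorated_asymm (hΓ : IsDynkinQuiver Γ) (a b : I ⊕ I)
    (h : (decorated Γ).Adj a b) : ¬ (decorated Γ).Adj b a := by
  rcases a with a | a <;> rcases b with b | b
  · exact hΓ.asymm a b h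
  all_goals exact h.elim

@[simp]
lemma decorated_graph_adj_inl_inl (a b : I) :
    (decorated Γ).toSimpleGraphInclusive.Adj (Sum.inl a) (Sum.inl b) ↔
      Γ.toSimpleGraphInclusive.Adj a b := by
  simp [Digraph.toSimpleGraphInclusive, decorated]

@[simp]
lemma decorated_graph_not_adj_inr_left (a : I) (b : I ⊕ I) :
    ¬ (decorated Γ).toSimpleGraphInclusive.Adj (Sum.inr a) b := by
  rcases b with b | b <;> simp [Digraph.toSimpleGraphInclusive, decorated]

@[simp]
lemma decorated_graph_not_adj_inr_right (a : I ⊕ I) (b : I) :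
    ¬ (decorated Γ).toSimpleGraphInclusive.Adj a (Sum.inr b) := fun h =>
  decorated_graph_not_adj_inr_left b a h.symm

lemma neighborSum_decorated_inl [Fintype I] (x : I ⊕ I → ℤ) (a : I) :
    neighborSum (decorated Γ).toSimpleGraphInclusive x (Sum.inl a) =
      neighborSum Γ.toSimpleGraphInclusive (x ∘ Sum.inl) a := by
  classical
  simp only [neighborSum, Fintype.sum_sum_type, decorated_graph_not_adj_inr_right, if_false,
    Finset.sum_const_zero, add_zero]
  exact Finset.sum_congr rfl fun b _ => if_congr (decorated_graph_adj_inl_inl a b) rfl rfl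

lemma neighborSum_decorated_inr [Fintype I] (x : I ⊕ I → ℤ) (a : I) :
    neighborSum (decorated Γ).toSimpleGraphInclusive x (Sum.inr a) = 0 := by
  simp [neighborSum]

lemma titsForm_decorated [Fintype I] (x : I ⊕ I → ℤ) :
    titsForm (decorated Γ).toSimpleGraphInclusive x =
      titsForm Γ.toSimpleGraphInclusive (x ∘ Sum.inl) + 2 * ∑ a, x (Sum.inr a) ^ 2 := by
  simp only [titsForm, Fintype.sum_sum_type, neighborSum_decorated_inl, neighborSum_decorated_inr,
    Function.comp_apply, mul_zero, Finset.sum_const_zero]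
  ring

/-- The isolated vertices only add orthogonal components of type A₁, so Gabriel's theorem can be
applied to the decorated quiver itself. -/
lemma titsForm_decorated_pos [Fintype I] (hΓ : IsDynkinQuiver Γ) {x : I ⊕ I → ℤ} (hx : x ≠ 0) :
    0 < titsForm (decorated Γ).toSimpleGraphInclusive x := by
  rw [titsForm_decorated]
  have h2 : ∀ a ∈ Finset.univ, 0 ≤ x (Sum.inr a) ^ 2 := fun a _ => sq_nonneg _
  have h3 := Finset.sum_nonneg h2
  by_cases h0 : x ∘ Sum.inl = 0
  · rw [h0, titsForm_zero, zero_add]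
    refine mul_pos two_pos (lt_of_le_of_ne h3 fun h4 => hx ?_)
    have h5 := (Finset.sum_eq_zero_iff_of_nonneg h2).1 h4.symm
    funext a
    rcases a with a | a
    · exact congrFun h0 a
    · exact pow_eq_zero_iff two_ne_zero |>.1 (h5 a (Finset.mem_univ a))
  · have := hΓ.dynkin.titsForm_pos h0
    linarith

lemma simpleReflection_decorated_inl [Fintype I] [DecidableEq I] (i : I) (x : I ⊕ I → ℤ) :
    simpleReflection (decorated Γ).toSimpleGraphInclusive (Sum.inl i) x ∘ Sum.inl =
      simpleReflection Γ.toSimpleGraphInclusive i (x ∘ Sum.inl) := by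
  rw [simpleReflection_eq, simpleReflection_eq]
  funext a
  by_cases ha : a = i
  · subst ha
    simp [rootPairing, neighborSum_decorated_inl]
  · simp [ha]

lemma simpleReflection_decorated_inr [Fintype I] [DecidableEq I] (i a : I) (x : I ⊕ I → ℤ) :
    simpleReflection (decorated Γ).toSimpleGraphInclusive (Sum.inl i) x (Sum.inr a) =
      x (Sum.inr a) :=
  simpleReflection_apply_of_ne (by simp) x

lemma isSinkReflection_reverseAt {i : I} (hi : IsSink Γ i) :
    IsSinkReflection Γ (reverseAt Γ i) i where
  sink := hi
  source j := by
    have := hi j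
    have := hi i
    simp only [reverseAt]
    grind
  adj_iff j := by
    simp [reverseAt]
  adj_iff_of_ne a b ha hb := by
    simp [reverseAt, ha, hb]

lemma IsSinkReflection.toDecorated {Γ' : Digraph I} {i : I} (h : IsSinkReflection Γ Γ' i) :
    IsSinkReflection (decorated Γ) (decorated Γ') (Sum.inl i) where
  sink j := by
    rcases j with j | j
    · exact h.sink j
    · exact id
  source j := by
    rcases j with j | j
    · exact h.source j
    · exact id
  adj_iff j := by
    rcases j with j | j
    · exact h.adj_iff j
    · exact Iff.rfl
  adj_iff_of_ne a b ha hb := by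
    rcases a with a | a <;> rcases b with b | b
    · exact h.adj_iff_of_ne a b (by simpa using ha) (by simpa using hb)
    all_goals exact Iff.rfl

lemma IsSinkReflection.isDynkinQuiver {Γ' : Digraph I} {i : I} (h : IsSinkReflection Γ Γ' i)
    (hΓ : IsDynkinQuiver Γ) : IsDynkinQuiver Γ' where
  asymm := h.asymm hΓ.asymm
  dynkin := h.toSimpleGraph_eq ▸ hΓ.dynkin

end DecoratedQuiver

/-! ### Decorated representations -/

section DecoratedRep

variable {I : Type v} {k : Type u} [Field k] {Γ : Digraph I}

lemma Rep.sdim_eq (M : Rep k (decorated Γ)) (a : I) :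
    M.sdim a = M.dimVec (Sum.inl a) - M.dimVec (Sum.inr a) := rfl

/-- No arrow meets a vertex `i⁻`, so `M` is the direct sum of M⁺ and V as a representation. -/
lemma Rep.Indecomposable.plus_or_dec {M : Rep k (decorated Γ)} (hM : M.Indecomposable) :
    (∀ a, M.dimVec (Sum.inl a) = 0) ∨ (∀ a, M.dimVec (Sum.inr a) = 0) := by
  rcases hM.eq_bot_or_eq_bot (fun a => if a.isLeft then ⊤ else ⊥)
      (fun a => if a.isLeft then ⊥ else ⊤)
      (by
        rintro (a | a) (b | b) h x hx
        · trivial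
        all_goals exact h.elim)
      (by
        rintro (a | a) (b | b) h x hx
        · have hx' : x = 0 := hx
          rw [hx', map_zero]
          exact Submodule.zero_mem _
        all_goals exact h.elim)
      (by
        rintro (a | a)
        · exact isCompl_top_bot
        · exact isCompl_bot_top) with h | h
  · refine Or.inl fun a => ?_
    have h1 : (⊤ : Submodule k (M.obj (Sum.inl a))) = ⊥ := h (Sum.inl a)
    have := (Submodule.subsingleton_iff k).1 (subsingleton_of_bot_eq_top h1.symm)
    exact M.dimVec_eq_zero _
  · refine Or.inr fun a => ?_
    have h1 : (⊤ : Submodule k (M.obj (Sum.inr a))) = ⊥ := h (Sum.inr a)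
    have := (Submodule.subsingleton_iff k).1 (subsingleton_of_bot_eq_top h1.symm)
    exact M.dimVec_eq_zero _

/-- The dimension vector of an indecomposable decorated representation is determined by its
signed dimension vector. -/
lemma Rep.Indecomposable.dimVec_eq_of_sdim {M N : Rep k (decorated Γ)} (hM : M.Indecomposable)
    (hN : N.Indecomposable) (h : M.sdim = N.sdim) : M.dimVec = N.dimVec := by
  -- In the mixed case a vector ≤ 0 equals a vector ≥ 0, so both vanish and `M` would be zero.
  have key : ∀ {M N : Rep k (decorated Γ)}, M.Indecomposable → M.sdim = N.sdim →
      (∀ a, M.dimVec (Sum.inl a) = 0) → (∀ a, N.dimVec (Sum.inr a) = 0) → False := by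
    intro M N hM h h1 h2
    refine hM.1 fun a => Rep.subsingleton_of_dimVec ?_
    rcases a with a | a
    · exact h1 a
    · have h3 := congrFun h a
      have h4 := N.dimVec_nonneg (Sum.inl a)
      have h5 := M.dimVec_nonneg (Sum.inr a)
      rw [Rep.sdim_eq, Rep.sdim_eq, h1, h2] at h3
      simp only [Pi.zero_apply] at h4 h5
      linarith
  funext a
  rcases hM.plus_or_dec with h1 | h1 <;> rcases hN.plus_or_dec with h2 | h2
  · rcases a with a | a
    · rw [h1, h2]
    · have h3 := congrFun h a
      rw [Rep.sdim_eq, Rep.sdim_eq, h1, h2] at h3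
      linarith
  · exact (key hM h h1 h2).elim
  · exact (key hN h.symm h2 h1).elim
  · rcases a with a | a
    · have h3 := congrFun h a
      rw [Rep.sdim_eq, Rep.sdim_eq, h1, h2] at h3
      linarith
    · rw [h1, h2]

variable [Fintype I] [DecidableEq I]

lemma IsDynkinQuiver.hasUniqueBrick (k : Type u) [Field k] (hΓ : IsDynkinQuiver Γ)
    {x : I ⊕ I → ℤ} (hx : 0 ≤ x)
    (hq : titsForm (decorated Γ).toSimpleGraphInclusive x = 2) :
    HasUniqueBrick k (decorated Γ) x :=
  hasUniqueBrick_of_titsForm k hΓ.decorated_asymm (fun _ hx => titsForm_decorated_pos hΓ hx) hx hq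

/-- Every indecomposable decorated representation whose dimension vector is a root represents its
signed dimension vector. -/
lemma Rep.Indecomposable.isRootRep (hΓ : IsDynkinQuiver Γ) {M : Rep k (decorated Γ)}
    (hM : M.Indecomposable)
    (hq : titsForm (decorated Γ).toSimpleGraphInclusive M.dimVec = 2) {α : I → ℤ}
    (hα : M.sdim = α) : M.IsRootRep α := by
  refine ⟨hM, hα, fun N hN hNα => ?_⟩
  obtain ⟨L, _, _, hL⟩ := hΓ.hasUniqueBrick k M.dimVec_nonneg hq
  exact (hL N hN (hN.dimVec_eq_of_sdim hM (hNα.trans hα.symm))).trans (hL M hM rfl).symm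

lemma exists_isRootRep_single (k : Type u) [Field k] (hΓ : IsDynkinQuiver Γ) (a : I ⊕ I) {α : I → ℤ}
    (hα : ∀ b, α b = (Pi.single a 1 : I ⊕ I → ℤ) (Sum.inl b) -
      (Pi.single a 1 : I ⊕ I → ℤ) (Sum.inr b)) :
    ∃ U : Rep k (decorated Γ), U.IsRootRep α ∧ U.dimVec = Pi.single a 1 := by
  have hq : titsForm (decorated Γ).toSimpleGraphInclusive (Pi.single a 1) = 2 := by
    simp [titsForm_single]
  obtain ⟨U, hU, hend, _⟩ := hΓ.hasUniqueBrick k (x := Pi.single a 1)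
    (Pi.single_nonneg.2 zero_le_one) hq
  refine ⟨U, (Rep.indecomposable_of_finrank_homSpace hend).isRootRep hΓ (by rw [hU, hq]) ?_, hU⟩
  funext b
  rw [Rep.sdim_eq, hU, hα]

omit [Fintype I] [DecidableEq I] in
/-- The extension groups do not see the decoration. -/
lemma finrank_ext1_plus (M N : Rep k (decorated Γ)) :
    Module.finrank k (Ext1 M.plus N.plus) = Module.finrank k (Ext1 M N) := by
  let r : Cocycle M N →ₗ[k] Cocycle M.plus N.plus :=
    { toFun := fun c a => c ⟨(Sum.inl a.1.1, Sum.inl a.1.2), a.2⟩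
      map_add' := fun _ _ => rfl
      map_smul' := fun _ _ => rfl }
  have hr : Function.Bijective r := by
    constructor
    · intro c d hcd
      funext ⟨⟨a, b⟩, h⟩
      rcases a with a | a <;> rcases b with b | b
      · exact congrFun hcd ⟨(a, b), h⟩
      all_goals exact h.elim
    · intro c
      refine ⟨fun a => match a with
        | ⟨(Sum.inl a, Sum.inl b), h⟩ => c ⟨(a, b), h⟩
        | ⟨(Sum.inl _, Sum.inr _), h⟩ => h.elim
        | ⟨(Sum.inr _, Sum.inl _), h⟩ => h.elim
        | ⟨(Sum.inr _, Sum.inr _), h⟩ => h.elim, rfl⟩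
  refine (Submodule.Quotient.equiv (LinearMap.range (coboundary M N))
    (LinearMap.range (coboundary M.plus N.plus)) (LinearEquiv.ofBijective r hr) ?_).finrank_eq.symm
  ext c
  constructor
  · rintro ⟨_, ⟨f, rfl⟩, rfl⟩
    exact ⟨fun a => f (Sum.inl a), rfl⟩
  · rintro ⟨f, rfl⟩
    refine ⟨_, ⟨fun a => match a with
      | Sum.inl a => f a
      | Sum.inr _ => 0, rfl⟩, rfl⟩

omit [DecidableEq I] in
lemma finrank_eSpace (M N : Rep k (decorated Γ)) :
    (Module.finrank k (ESpace M N) : ℤ) =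
      Module.finrank k (Ext1 M N) + Module.finrank k (Ext1 N M) +
        (∑ j, M.dimVec (Sum.inl j) * N.dimVec (Sum.inr j) +
          ∑ j, M.dimVec (Sum.inr j) * N.dimVec (Sum.inl j)) := by
  have h1 : Module.finrank k (ESpace M N) = Module.finrank k (Ext1 M.plus N.plus) +
      (Module.finrank k (Module.Dual k (Ext1 N.plus M.plus)) +
        (Module.finrank k (∀ i, M.plus.obj i →ₗ[k] N.dec i) +
          Module.finrank k (∀ i, M.dec i →ₗ[k] N.plus.obj i))) := by
    rw [Module.finrank_prod, Module.finrank_prod, Module.finrank_prod]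
  rw [h1, Subspace.dual_finrank_eq, finrank_ext1_plus, finrank_ext1_plus,
    Module.finrank_pi_fintype, Module.finrank_pi_fintype]
  simp only [Module.finrank_linearMap]
  push_cast
  rw [add_assoc]
  rfl

omit [DecidableEq I] in
lemma finrank_eSpace_comm (M N : Rep k (decorated Γ)) :
    Module.finrank k (ESpace M N) = Module.finrank k (ESpace N M) := by
  have h1 := finrank_eSpace M N
  have h2 := finrank_eSpace N M
  simp only [mul_comm (M.dimVec _)] at h1
  have : (Module.finrank k (ESpace M N) : ℤ) = Module.finrank k (ESpace N M) := by
    rw [h1, h2]; ring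
  exact_mod_cast this

lemma sum_single_inl_mul (i : I) (f : I → ℤ) :
    ∑ j, (Pi.single (Sum.inl i) 1 : I ⊕ I → ℤ) (Sum.inl j) * f j = f i := by
  rw [Finset.sum_eq_single i]
  · simp
  · intro j _ hj
    rw [Pi.single_eq_of_ne (by simpa using hj), zero_mul]
  · simp

lemma sum_single_inr_mul (i : I) (f : I → ℤ) :
    ∑ j, (Pi.single (Sum.inr i) 1 : I ⊕ I → ℤ) (Sum.inr j) * f j = f i := by
  rw [Finset.sum_eq_single i]
  · simp
  · intro j _ hj
    rw [Pi.single_eq_of_ne (by simpa using hj), zero_mul]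
  · simp

omit [Fintype I] in
lemma Rep.subsingleton_of_dimVec_eq_single {V : Type v} [DecidableEq V] {Γ : Digraph V}
    {M : Rep k Γ} {i : V} (hM : M.dimVec = Pi.single i 1) {a : V} (ha : a ≠ i) :
    Subsingleton (M.obj a) :=
  Rep.subsingleton_of_dimVec (by rw [hM, Pi.single_eq_of_ne ha])

/-- Here M⁺ = 0 and V is one-dimensional at `i`, so only the summand Hom(V_i, N_i) survives. -/
lemma finrank_eSpace_inr {M : Rep k (decorated Γ)} {i : I}
    (hM : M.dimVec = Pi.single (Sum.inr i) 1) (N : Rep k (decorated Γ)) :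
    (Module.finrank k (ESpace M N) : ℤ) = N.dimVec (Sum.inl i) := by
  have hs : ∀ a, Subsingleton (M.obj (Sum.inl a)) := fun a =>
    Rep.subsingleton_of_dimVec_eq_single hM (by simp)
  have h1 : Module.finrank k (Ext1 M N) = 0 := finrank_ext1_eq_zero_of_cocycle _ _ (by
    rintro (a | a) (b | b) h
    · exact Or.inl (hs a)
    all_goals exact h.elim)
  have h2 : Module.finrank k (Ext1 N M) = 0 := finrank_ext1_eq_zero_of_cocycle _ _ (by
    rintro (a | a) (b | b) h
    · exact Or.inr (hs b)
    all_goals exact h.elim)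
  rw [finrank_eSpace, h1, h2, hM, sum_single_inr_mul]
  simp

lemma finrank_eSpace_inl_inl (hΓ : IsDynkinQuiver Γ) {M N : Rep k (decorated Γ)} {i : I}
    (hM : M.dimVec = Pi.single (Sum.inl i) 1) (hN : N.dimVec = Pi.single (Sum.inl i) 1) :
    (Module.finrank k (ESpace M N) : ℤ) = 0 := by
  have key : ∀ {M N : Rep k (decorated Γ)}, M.dimVec = Pi.single (Sum.inl i) 1 →
      N.dimVec = Pi.single (Sum.inl i) 1 → Module.finrank k (Ext1 M N) = 0 := by
    intro M N hM hN
    refine finrank_ext1_eq_zero_of_cocycle _ _ fun a b h => ?_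
    by_cases ha : a = Sum.inl i
    · refine Or.inr (Rep.subsingleton_of_dimVec_eq_single hN ?_)
      rintro rfl
      subst ha
      exact hΓ.decorated_asymm _ _ h h
    · exact Or.inl (Rep.subsingleton_of_dimVec_eq_single hM ha)
  rw [finrank_eSpace, key hM hN, key hN hM, hM, hN]
  simp

end DecoratedRep

/-! ### Invariance of the compatibility degree -/

section Invariance

variable {I : Type v} [Fintype I] [DecidableEq I] {k : Type u} [Field k] {Γ Γ' : Digraph I} {i : I}

namespace IsSinkReflection

/-- Hom dimensions and the Euler form are both invariant, hence so is dim Ext¹ in either order.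
Decoration products at j ≠ i are untouched; at `i` they vanish because neither side has a decoration
there. -/
lemma finrank_eSpace_generic (h : IsSinkReflection Γ Γ' i)
    {M N : Rep k (decorated Γ)} {M' N' : Rep k (decorated Γ')}
    (R : ReflectionData (Sum.inl i) M M') (S : ReflectionData (Sum.inl i) N N')
    (hM : M.dimVec (Sum.inr i) = 0) (hN : N.dimVec (Sum.inr i) = 0) :
    (Module.finrank k (ESpace M' N') : ℤ) = Module.finrank k (ESpace M N) := by
  have key : ∀ {M N : Rep k (decorated Γ)} {M' N' : Rep k (decorated Γ')},
      ReflectionData (Sum.inl i) M M' → ReflectionData (Sum.inl i) N N' →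
      (Module.finrank k (Ext1 M' N') : ℤ) = Module.finrank k (Ext1 M N) := by
    intro M N M' N' R S
    have h1 := finrank_homSpace_sub_finrank_ext1 M N
    have h2 := finrank_homSpace_sub_finrank_ext1 M' N'
    rw [R.dimVec_eq h.toDecorated, S.dimVec_eq h.toDecorated, h.toDecorated.eulerForm_eq,
      R.finrank_homSpace_eq h.toDecorated S] at h2
    linarith
  have hr : ∀ {M : Rep k (decorated Γ)} {M' : Rep k (decorated Γ')},
      ReflectionData (Sum.inl i) M M' → ∀ j, M'.dimVec (Sum.inr j) = M.dimVec (Sum.inr j) :=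
    fun R j => R.dimVec_of_ne (by simp)
  rw [finrank_eSpace, finrank_eSpace, key R S, key S R]
  congr 2
  · refine Finset.sum_congr rfl fun j _ => ?_
    by_cases hj : j = i
    · rw [hr S, hj, hN, mul_zero, mul_zero]
    · rw [hr S, R.dimVec_of_ne (by simpa using hj)]
  · refine Finset.sum_congr rfl fun j _ => ?_
    by_cases hj : j = i
    · rw [hr R, hj, hM, zero_mul, zero_mul]
    · rw [hr R, S.dimVec_of_ne (by simpa using hj)]

/-- For the simple S_i at a sink, Ext¹(S_i, N) = 0 as no arrow leaves `i`, and Hom(N, S_i) = 0 as N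
is generated at `i` by its neighbours. So dim Ext¹(N, S_i) = -⟨N, S_i⟩ = Σ dim N_j - dim N_i, which
is dim N'_i. -/
lemma finrank_eSpace_sink (h : IsSinkReflection Γ Γ' i) {M N : Rep k (decorated Γ)}
    {N' : Rep k (decorated Γ')} (hM : M.dimVec = Pi.single (Sum.inl i) 1)
    (S : ReflectionData (Sum.inl i) N N') (hN : N.dimVec (Sum.inr i) = 0) :
    (Module.finrank k (ESpace M N) : ℤ) = N'.dimVec (Sum.inl i) := by
  classical
  have hs : ∀ a, a ≠ Sum.inl i → Subsingleton (M.obj a) := fun a =>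
    Rep.subsingleton_of_dimVec_eq_single hM
  have hsink := h.toDecorated.sink
  have h1 : Module.finrank k (Ext1 M N) = 0 := finrank_ext1_eq_zero_of_cocycle _ _ fun a b hab =>
    Or.inl (hs a fun ha => hsink b (ha ▸ hab))
  have h2 : Module.finrank k (homSpace N M) = 0 := by
    have : Subsingleton (homSpace N M) := by
      refine subsingleton_of_forall_eq 0 fun f => Subtype.ext (funext fun a => ?_)
      by_cases ha : a = Sum.inl i
      · subst ha
        refine LinearMap.ext fun z => ?_
        obtain ⟨x, rfl⟩ := S.full z
        rw [inMap_hom fun b hb x => mem_homSpace.1 f.2 b _ hb x]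
        have h0 : M.inMap (Sum.inl i) (fun b => f.1 b (x b)) = M.inMap (Sum.inl i) 0 :=
          M.inMap_congr fun b hb => by
            have := hs b fun hbi => hsink _ (hbi ▸ hb)
            exact Subsingleton.elim _ _
        rw [h0, map_zero]
        rfl
      · have := hs a ha
        exact LinearMap.ext fun x => Subsingleton.elim _ _
    exact Module.finrank_zero_of_subsingleton
  have h3 := finrank_homSpace_sub_finrank_ext1 N M
  have h4 := S.dimVec_add_dimVec h.toDecorated
  have h5 : eulerForm (decorated Γ) N.dimVec (Pi.single (Sum.inl i) 1) =
      N.dimVec (Sum.inl i) - ∑ a, if (decorated Γ).Adj a (Sum.inl i) then N.dimVec a else 0 := by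
    rw [eulerForm]
    congr 1
    · rw [Finset.sum_eq_single (Sum.inl i)]
      · simp
      · intro b _ hb
        rw [Pi.single_eq_of_ne hb, mul_zero]
      · simp
    · refine Finset.sum_congr rfl fun a _ => ?_
      rw [Finset.sum_eq_single (Sum.inl i)]
      · simp
      · intro b _ hb
        rw [Pi.single_eq_of_ne hb, mul_zero, ite_self]
      · simp
  rw [hM, h5, h2] at h3
  rw [finrank_eSpace, h1, hM, sum_single_inl_mul, hN]
  simp only [Pi.single_eq_of_ne (Sum.inr_ne_inl), zero_mul, Finset.sum_const_zero]
  push_cast at h3 ⊢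
  linarith

/-- The mirror image at the source `i` of Γ': Ext¹(N', S_i) and Hom(S_i, N') vanish, and dim
Ext¹(S_i, N') = Σ dim N_j - dim N'_i = dim N_i. -/
lemma finrank_eSpace_source (h : IsSinkReflection Γ Γ' i) {N : Rep k (decorated Γ)}
    {M' N' : Rep k (decorated Γ')} (hM : M'.dimVec = Pi.single (Sum.inl i) 1)
    (S : ReflectionData (Sum.inl i) N N') (hN : N.dimVec (Sum.inr i) = 0) :
    (Module.finrank k (ESpace M' N') : ℤ) = N.dimVec (Sum.inl i) := by
  classical
  have hs : ∀ a, a ≠ Sum.inl i → Subsingleton (M'.obj a) := fun a =>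
    Rep.subsingleton_of_dimVec_eq_single hM
  have hsource := h.toDecorated.source
  have h1 : Module.finrank k (Ext1 N' M') = 0 := finrank_ext1_eq_zero_of_cocycle _ _ fun a b hab =>
    Or.inr (hs b fun hb => hsource a (hb ▸ hab))
  have h2 : Module.finrank k (homSpace M' N') = 0 := by
    have : Subsingleton (homSpace M' N') := by
      refine subsingleton_of_forall_eq 0 fun f => Subtype.ext (funext fun a => ?_)
      by_cases ha : a = Sum.inl i
      · subst ha
        refine LinearMap.ext fun z => S.cofull _ fun j hj => ?_
        have := hs j fun hji => hsource _ (hji ▸ hj)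
        rw [← mem_homSpace.1 f.2, Subsingleton.elim (M'.map hj z) 0, map_zero]
      · have := hs a ha
        exact LinearMap.ext fun x => by rw [Subsingleton.elim x 0, map_zero, map_zero]
    exact Module.finrank_zero_of_subsingleton
  have h3 := finrank_homSpace_sub_finrank_ext1 M' N'
  have h4 := S.dimVec_add_dimVec h.toDecorated
  have h5 : eulerForm (decorated Γ') (Pi.single (Sum.inl i) 1) N'.dimVec =
      N'.dimVec (Sum.inl i) - ∑ a, if (decorated Γ).Adj a (Sum.inl i) then N.dimVec a else 0 := by
    rw [eulerForm]
    congr 1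
    · rw [Finset.sum_eq_single (Sum.inl i)]
      · simp
      · intro b _ hb
        rw [Pi.single_eq_of_ne hb, zero_mul]
      · simp
    · rw [Finset.sum_eq_single (Sum.inl i)]
      · refine Finset.sum_congr rfl fun a _ => ?_
        simp only [h.toDecorated.adj_iff, Pi.single_eq_same, one_mul]
        split_ifs with ha
        · exact S.dimVec_of_ne fun hai => h.toDecorated.sink _ (hai ▸ ha)
        · rfl
      · intro b _ hb
        refine Finset.sum_eq_zero fun a _ => ?_
        rw [Pi.single_eq_of_ne hb, zero_mul, ite_self]
      · simp
  have h6 : N'.dimVec (Sum.inr i) = 0 := by rw [S.dimVec_of_ne (by simp), hN]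
  rw [hM, h5, h2] at h3
  rw [finrank_eSpace, h1, hM, sum_single_inl_mul, h6]
  simp only [Pi.single_eq_of_ne (Sum.inr_ne_inl), zero_mul, Finset.sum_const_zero]
  push_cast at h3 ⊢
  linarith

end IsSinkReflection

/-- The decorated representations `U` and `U'` correspond to each other under the reflection at
`i`: either by reflection functors, or by exchanging the simple representations at `i` and `i⁻`. -/
def IsReflectionPair (i : I) (U : Rep k (decorated Γ)) (U' : Rep k (decorated Γ')) : Prop :=
  (Nonempty (ReflectionData (Sum.inl i) U U') ∧ U.dimVec (Sum.inr i) = 0) ∨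
  (U.dimVec = Pi.single (Sum.inl i) 1 ∧ U'.dimVec = Pi.single (Sum.inr i) 1) ∨
  (U.dimVec = Pi.single (Sum.inr i) 1 ∧ U'.dimVec = Pi.single (Sum.inl i) 1)

theorem IsReflectionPair.finrank_eSpace_eq (h : IsSinkReflection Γ Γ' i) (hΓ : IsDynkinQuiver Γ)
    {U W : Rep k (decorated Γ)} {U' W' : Rep k (decorated Γ')} (hU : IsReflectionPair i U U')
    (hW : IsReflectionPair i W W') :
    Module.finrank k (ESpace U' W') = Module.finrank k (ESpace U W) := by
  have hΓ' := h.isDynkinQuiver hΓ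
  suffices (Module.finrank k (ESpace U' W') : ℤ) = Module.finrank k (ESpace U W) by
    exact_mod_cast this
  -- Nine cases. One exceptional partner is handled by the sink or source formula against the simple
  -- at `i⁻`. With two, the degrees are 0 for equal simples and 1 for the simples at `i` and `i⁻`,
  -- on both sides.
  rcases hU with ⟨⟨R⟩, hU⟩ | ⟨hU, hU'⟩ | ⟨hU, hU'⟩ <;>
    rcases hW with ⟨⟨S⟩, hW⟩ | ⟨hW, hW'⟩ | ⟨hW, hW'⟩
  · exact h.finrank_eSpace_generic R S hU hW
  · rw [finrank_eSpace_comm U', finrank_eSpace_comm U, h.finrank_eSpace_sink hW R hU,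
      finrank_eSpace_inr hW']
  · rw [finrank_eSpace_comm U', finrank_eSpace_comm U, h.finrank_eSpace_source hW' R hU,
      finrank_eSpace_inr hW]
  · rw [h.finrank_eSpace_sink hU S hW, finrank_eSpace_inr hU']
  · rw [finrank_eSpace_inl_inl hΓ hU hW, finrank_eSpace_inr hU', hW']
    simp
  · rw [finrank_eSpace_inr hU', finrank_eSpace_comm U, finrank_eSpace_inr hW, hU, hW']
  · rw [h.finrank_eSpace_source hU' S hW, finrank_eSpace_inr hU]
  · rw [finrank_eSpace_inr hU, finrank_eSpace_comm U', finrank_eSpace_inr hW', hU', hW]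
  · rw [finrank_eSpace_inl_inl hΓ' hU' hW', finrank_eSpace_inr hU, hW]
    simp

/-- Covers both the positive roots other than α_i and the negative simple roots -α_j with j ≠ i, by
working with dimension vectors on the decorated quiver. -/
lemma exists_generic_pair (k : Type u) [Field k] (h : IsSinkReflection Γ Γ' i)
    (hΓ : IsDynkinQuiver Γ) {x : I ⊕ I → ℤ} (hx : 0 ≤ x)
    (hq : titsForm (decorated Γ).toSimpleGraphInclusive x = 2) (hne : x ≠ Pi.single (Sum.inl i) 1)
    (hi : x (Sum.inr i) = 0) {α β : I → ℤ} (hα : ∀ a, α a = x (Sum.inl a) - x (Sum.inr a))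
    (hβ : ∀ a, β a = simpleReflection Γ.toSimpleGraphInclusive i (x ∘ Sum.inl) a - x (Sum.inr a)) :
    ∃ (U : Rep k (decorated Γ)) (U' : Rep k (decorated Γ')),
      U.IsRootRep α ∧ U'.IsRootRep β ∧ IsReflectionPair i U U' := by
  have hΓ' := h.isDynkinQuiver hΓ
  obtain ⟨U, hU, hend, _⟩ := hΓ.hasUniqueBrick k hx hq
  have hind := Rep.indecomposable_of_finrank_homSpace hend
  obtain ⟨U', ⟨R⟩⟩ := exists_reflection h.toDecorated
    (hind.isFull h.toDecorated.sink (by rw [hU, hq]) (by rw [hU]; exact hne))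
  have hU' := R.dimVec_eq h.toDecorated
  rw [hU] at hU'
  refine ⟨U, U', hind.isRootRep hΓ (by rw [hU, hq]) ?_,
    (R.indecomposable h.toDecorated hind).isRootRep hΓ' ?_ ?_, Or.inl ⟨⟨R⟩, by rw [hU, hi]⟩⟩
  · funext a
    rw [Rep.sdim_eq, hU, hα]
  · rw [h.toDecorated.toSimpleGraph_eq, hU', titsForm_simpleReflection, hq]
  · funext a
    rw [Rep.sdim_eq, hU', hβ, simpleReflection_decorated_inr, ← simpleReflection_decorated_inl]
    rfl

/-! ### Truncated reflections on almost positive roots -/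

omit [Fintype I] in
lemma pi_single_sum_apply (a b : I) :
    (Pi.single (Sum.inl a) 1 : I ⊕ I → ℤ) (Sum.inl b) = (Pi.single a 1 : I → ℤ) b ∧
      (Pi.single (Sum.inr a) 1 : I ⊕ I → ℤ) (Sum.inr b) = (Pi.single a 1 : I → ℤ) b := by
  by_cases hb : b = a
  · subst hb; simp
  · simp [hb]

lemma truncatedReflection_of_nonneg (G : SimpleGraph I) (i : I) {α : I → ℤ} (hα : ∀ j, 0 ≤ α j) :
    truncatedReflection G i α = simpleReflection G i α := by
  simp only [truncatedReflection, simpleReflection, max_eq_left (hα _)]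

lemma truncatedReflection_neg_single (G : SimpleGraph I) (i j : I) :
    truncatedReflection G i (-Pi.single j 1) = if j = i then Pi.single i 1 else -Pi.single j 1 := by
  have h0 : ∀ a, max ((-Pi.single j 1 : I → ℤ) a) 0 = 0 := fun a => by
    by_cases ha : a = j
    · subst ha; simp
    · simp [ha]
  funext a
  simp only [truncatedReflection, h0, ite_self, Finset.sum_const_zero, add_zero]
  by_cases hj : j = i
  · subst hj
    by_cases ha : a = j
    · subst ha; simp
    · simp [ha]
  · rw [if_neg hj]
    by_cases ha : a = i
    · subst ha
      simp [Ne.symm hj]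
    · simp [ha]

lemma truncatedReflection_single (G : SimpleGraph I) (i : I) :
    truncatedReflection G i (Pi.single i 1) = -Pi.single i 1 := by
  rw [truncatedReflection_of_nonneg G i fun j =>
      (Pi.single_nonneg.2 zero_le_one : (0 : I → ℤ) ≤ _) j, simpleReflection_eq]
  simp [rootPairing, neighborSum_single, ← Pi.single_add, ← Pi.single_neg]

/-- The correction term depends only on coordinates at neighbours of `i`, which σ_i does not change.
-/
lemma truncatedReflection_truncatedReflection (G : SimpleGraph I) (i : I) (α : I → ℤ) :
    truncatedReflection G i (truncatedReflection G i α) = α := by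
  have h : ∀ j, j ≠ i → truncatedReflection G i α j = α j := fun j hj => by
    simp [truncatedReflection, hj]
  classical
  funext a
  by_cases ha : a = i
  · subst ha
    have h1 : (∑ j, if G.Adj j a then max (truncatedReflection G a α j) 0 else 0) =
        ∑ j, if G.Adj j a then max (α j) 0 else 0 := by
      refine Finset.sum_congr rfl fun j _ => ?_
      split_ifs with hj
      · rw [h j hj.ne]
      · rfl
    have h2 : ∀ γ : I → ℤ, truncatedReflection G a γ a =
        -γ a + ∑ j, if G.Adj j a then max (γ j) 0 else 0 := fun γ => by
      simp only [truncatedReflection, Function.update_self]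
    rw [h2, h1, h2]
    ring
  · rw [truncatedReflection, Function.update_of_ne ha, h a ha]

/-- The truncated reflections preserve the set of almost positive roots. -/
theorem truncatedReflection_mem {G : SimpleGraph I} (hG : IsDynkinGraph G) (i : I) {α : I → ℤ}
    (hα : α ∈ almostPositiveRoots G) : truncatedReflection G i α ∈ almostPositiveRoots G := by
  rcases hα with ⟨hr, hnn⟩ | ⟨j, rfl⟩
  · by_cases h1 : α = Pi.single i 1
    · rw [h1, truncatedReflection_single]
      exact Or.inr ⟨i, rfl⟩
    · rw [truncatedReflection_of_nonneg G i hnn]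
      exact Or.inl ⟨hr.reflect i,
        simpleReflection_nonneg (fun _ hx => hG.titsForm_pos hx) hnn hr.titsForm_eq h1⟩
  · rw [truncatedReflection_neg_single]
    split_ifs
    · exact Or.inl ⟨.simple i, (Pi.single_nonneg.2 zero_le_one : (0 : I → ℤ) ≤ _)⟩
    · exact Or.inr ⟨j, rfl⟩

lemma exists_pair (k : Type u) [Field k] (h : IsSinkReflection Γ Γ' i) (hΓ : IsDynkinQuiver Γ)
    {α : I → ℤ} (hα : α ∈ almostPositiveRoots Γ.toSimpleGraphInclusive) :
    ∃ (U : Rep k (decorated Γ)) (U' : Rep k (decorated Γ')), U.IsRootRep α ∧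
      U'.IsRootRep (truncatedReflection Γ.toSimpleGraphInclusive i α) ∧
      IsReflectionPair i U U' := by
  have hΓ' := h.isDynkinQuiver hΓ
  have hp := pi_single_sum_apply (I := I)
  rcases hα with ⟨hr, hnn⟩ | ⟨j, rfl⟩
  · by_cases h1 : α = Pi.single i 1
    · subst h1
      rw [truncatedReflection_single]
      obtain ⟨U, hU, hUd⟩ := exists_isRootRep_single k hΓ (Sum.inl i) (α := Pi.single i 1)
        fun b => by simp [(hp i b).1]
      obtain ⟨U', hU', hUd'⟩ := exists_isRootRep_single k hΓ' (Sum.inr i) (α := -Pi.single i 1)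
        fun b => by simp [(hp i b).2]
      exact ⟨U, U', hU, hU', Or.inr (Or.inl ⟨hUd, hUd'⟩)⟩
    · rw [truncatedReflection_of_nonneg _ _ hnn]
      refine exists_generic_pair k h hΓ (x := Sum.elim α 0) ?_ ?_ ?_ rfl (fun a => by simp)
        fun a => by simp
      · rintro (a | a)
        · exact hnn a
        · exact le_rfl
      · rw [titsForm_decorated]
        simp [hr.titsForm_eq]
      · intro h0
        refine h1 (funext fun a => ?_)
        rw [← (hp i a).1, ← h0]
        rfl
  · rw [truncatedReflection_neg_single]
    split_ifs with hj
    · subst hj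
      obtain ⟨U, hU, hUd⟩ := exists_isRootRep_single k hΓ (Sum.inr j) (α := -Pi.single j 1)
        fun b => by simp [(hp j b).2]
      obtain ⟨U', hU', hUd'⟩ := exists_isRootRep_single k hΓ' (Sum.inl j) (α := Pi.single j 1)
        fun b => by simp [(hp j b).1]
      exact ⟨U, U', hU, hU', Or.inr (Or.inr ⟨hUd, hUd'⟩)⟩
    -- For j ≠ i the simple at the isolated vertex `j⁻` has no Γ-part, so the reflection at `i`
    -- fixes its dimension vector.
    · have h0 : (Pi.single (Sum.inr j) 1 : I ⊕ I → ℤ) ∘ Sum.inl = 0 := by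
        funext a
        simp
      have h00 : simpleReflection Γ.toSimpleGraphInclusive i 0 = 0 := by
        simp [simpleReflection_eq, rootPairing, neighborSum]
      refine exists_generic_pair k h hΓ (x := Pi.single (Sum.inr j) 1)
        (Pi.single_nonneg.2 zero_le_one) (by simp [titsForm_single]) ?_ ?_
        (fun a => by simp [(hp j a).2]) fun a => by simp [(hp j a).2, h0, h00]
      · intro h1
        have := congrFun h1 (Sum.inr j)
        simp at this
      · rw [(hp j i).2, Pi.single_eq_of_ne (Ne.symm hj)]

lemma hasCompatDegree_reflection (k : Type u) [Field k] (h : IsSinkReflection Γ Γ' i)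
    (hΓ : IsDynkinQuiver Γ) {α β : I → ℤ}
    (hα : α ∈ almostPositiveRoots Γ.toSimpleGraphInclusive)
    (hβ : β ∈ almostPositiveRoots Γ.toSimpleGraphInclusive) :
    ∃ d : ℕ, HasCompatDegree k Γ α β d ∧
      HasCompatDegree k Γ' (truncatedReflection Γ.toSimpleGraphInclusive i α)
        (truncatedReflection Γ.toSimpleGraphInclusive i β) d := by
  obtain ⟨U, U', hU, hU', hUU⟩ := exists_pair k h hΓ hα
  obtain ⟨W, W', hW, hW', hWW⟩ := exists_pair k h hΓ hβ
  exact ⟨_, ⟨U, W, hU, hW, rfl⟩, ⟨U', W', hU', hW', hUU.finrank_eSpace_eq h hΓ hWW⟩⟩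

omit [Fintype I] [DecidableEq I] in
lemma isSinkReflection_of_isSource (hi : IsSource Γ i) :
    IsSinkReflection (reverseAt Γ i) Γ i where
  sink j := by
    have := hi j
    have := hi i
    simp only [reverseAt]
    grind
  source := hi
  adj_iff j := by
    simp [reverseAt]
  adj_iff_of_ne a b ha hb := by
    simp [reverseAt, ha, hb]

end Invariance

end DecQuiver

theorem proposition4p9 {k : Type u} [Field k] [IsAlgClosed k]
    {I : Type v} [Fintype I] [DecidableEq I]
    (Γ : Digraph I) (hΓ : DecQuiver.IsDynkinQuiver Γ)
    (i : I) (hi : DecQuiver.IsSource Γ i ∨ DecQuiver.IsSink Γ i)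
    (α β : I → ℤ)
    (hα : α ∈ DecQuiver.almostPositiveRoots Γ.toSimpleGraphInclusive)
    (hβ : β ∈ DecQuiver.almostPositiveRoots Γ.toSimpleGraphInclusive) :
    DecQuiver.truncatedReflection Γ.toSimpleGraphInclusive i α ∈
        DecQuiver.almostPositiveRoots Γ.toSimpleGraphInclusive ∧
      DecQuiver.truncatedReflection Γ.toSimpleGraphInclusive i β ∈
        DecQuiver.almostPositiveRoots Γ.toSimpleGraphInclusive ∧
      ∃ d : ℕ, DecQuiver.HasCompatDegree k Γ α β d ∧
        DecQuiver.HasCompatDegree k (DecQuiver.reverseAt Γ i)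
          (DecQuiver.truncatedReflection Γ.toSimpleGraphInclusive i α)
          (DecQuiver.truncatedReflection Γ.toSimpleGraphInclusive i β) d := by
  have hα' := DecQuiver.truncatedReflection_mem hΓ.dynkin i hα
  have hβ' := DecQuiver.truncatedReflection_mem hΓ.dynkin i hβ
  refine ⟨hα', hβ', ?_⟩
  rcases hi with hi | hi
  -- A source of Γ is a sink of `reverseAt Γ i`, and reflecting there leads back to Γ. The sink case
  -- is applied to σ_i α and σ_i β, and the involution returns α and β.
  · have h := DecQuiver.isSinkReflection_of_isSource hi
    have hG := h.toSimpleGraph_eq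
    have hrev : DecQuiver.IsDynkinQuiver (DecQuiver.reverseAt Γ i) := by
      refine ⟨fun a b hab hba => ?_, hG ▸ hΓ.dynkin⟩
      have := hΓ.asymm a b
      simp only [DecQuiver.reverseAt] at hab hba
      grind
    rw [hG] at hα' hβ' ⊢
    obtain ⟨d, h1, h2⟩ := DecQuiver.hasCompatDegree_reflection k h hrev hα' hβ'
    rw [DecQuiver.truncatedReflection_truncatedReflection,
      DecQuiver.truncatedReflection_truncatedReflection] at h2
    exact ⟨d, h2, h1⟩
  · exact DecQuiver.hasCompatDegree_reflection k (DecQuiver.isSinkReflection_reverseAt hi) hΓ hα hβ
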